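/- Let $L_1,L_2>0$, $\Omega=(0,L_1)\times(0,L_2)$, and let $\Gamma_W,\Gamma_E,\Gamma_S,\Gamma_N$ be the sides $x=0$, $x=L_1$, $y=0$, $y=L_2$ of $\Omega$. Let $\alpha_1,\alpha_2,\beta_1,\beta_2\in\mathbb R$ satisfy $$\alpha_1>0,\quad \alpha_2>0,\quad \alpha_2\beta_1-\alpha_1\beta_2\neq 0,$$ and put $$T_1=\begin{pmatrix}\alpha_1&\beta_1\\ \beta_1&-\alpha_1\end{pmatrix},\qquad T_2=\begin{pmatrix}\alpha_2&\beta_2\\ \beta_2&-\alpha_2\end{pmatrix}.$$ For $\Theta=(\theta_1,\theta_2)^t$ consider the boundary conditions $$\theta_1=0\ \text{ on }\Gamma_W\cup\Gamma_S,\qquad \theta_2=0\ \text{ on }\Gamma_E\cup\Gamma_N, \tag{BC}$$ understood in the sense of traces on the open sides of $\Omega$. Let $V=\{\Theta\in H^1(\Omega)^2 : \Theta \text{ satisfies (BC)}\}$ and let $\mathcal T$ be the unbounded operator in the real Hilbert space $L^2(\Omega)^2$ with domain $\mathcal D(\mathcal T)=V$ and $\mathcal T\Theta=T_1\Theta_x+T_2\Theta_y$.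 Then: 1. $\mathcal D(\mathcal T)=V$ is dense in $L^2(\Omega)^2$ (so that the adjoint $\mathcal T^*$ is defined), and $\mathcal T$ is positive: $\langle\mathcal T\Theta,\Theta\rangle_{L^2(\Omega)^2}\ge 0$ for every $\Theta\in V$. 2. The adjoint $\mathcal T^*$ is positive: $\langle\mathcal T^*\overline\Theta,\overline\Theta\rangle_{L^2(\Omega)^2}\ge 0$ for every $\overline\Theta\in\mathcal D(\mathcal T^*)$. 3. Let $\mathcal T_{\max}$ be the extension of $\mathcal T$, given by the same expression in the sense of distributions, to the domain $\{\Theta\in L^2(\Omega)^2 : T_1\Theta_x+T_2\Theta_y\in L^2(\Omega)^2,\ \Theta\text{ satisfies (BC)}\}$, where the traces are taken in the sense of distributions on the open sides. Then the adjoint of $\mathcal T_{\max}$ is positive as well. -/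

import Mathlib

open MeasureTheory Set Filter Topology
open scoped ContDiff LinearPMap

noncomputable section

namespace EllipticMode

/-- The open rectangle `Ω = (0, L₁) × (0, L₂)`. -/
def rect (L₁ L₂ : ℝ) : Set (ℝ × ℝ) := Ioo 0 L₁ ×ˢ Ioo 0 L₂

/-- The real Hilbert space `L²(Ω)²`, with `⟪Θ, Ψ⟫ = ∫_Ω Θ ⬝ Ψ`. -/
abbrev L2Vec (L₁ L₂ : ℝ) : Type :=
  Lp (EuclideanSpace ℝ (Fin 2)) 2 ((volume : Measure (ℝ × ℝ)).restrict (rect L₁ L₂))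

/-- Smooth functions with compact support contained in the open set `U`. -/
def IsTestFunction {E : Type*} [NormedAddCommGroup E] [NormedSpace ℝ E] (U : Set E)
    (φ : E → ℝ) : Prop :=
  ContDiff ℝ ∞ φ ∧ HasCompactSupport φ ∧ tsupport φ ⊆ U

/-- The partial derivative `∂φ/∂x` of a function on the plane. -/
def dx (φ : ℝ × ℝ → ℝ) (p : ℝ × ℝ) : ℝ := fderiv ℝ φ p (1, 0)

/-- The partial derivative `∂φ/∂y` of a function on the plane. -/
def dy (φ : ℝ × ℝ → ℝ) (p : ℝ × ℝ) : ℝ := fderiv ℝ φ p (0, 1)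

variable {L₁ L₂ : ℝ}

/-- `∫_S θᵢ g dx dy`, where `θ₀, θ₁` are the two components of `Θ`. -/
def pairing (S : Set (ℝ × ℝ)) (Θ : L2Vec L₁ L₂) (i : Fin 2) (g : ℝ × ℝ → ℝ) : ℝ :=
  ∫ p in S, (Θ p) i * g p

/-- `A Θ_x + B Θ_y = F` in the sense of distributions on `Ω`, for constant matrices `A`, `B`. -/
def IsWeakImage (A B : Matrix (Fin 2) (Fin 2) ℝ) (Θ F : L2Vec L₁ L₂) : Prop :=
  ∀ φ : ℝ × ℝ → ℝ, IsTestFunction (rect L₁ L₂) φ → ∀ i : Fin 2,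
    pairing (rect L₁ L₂) F i φ =
      -∑ j : Fin 2, (A i j * pairing (rect L₁ L₂) Θ j (dx φ) +
        B i j * pairing (rect L₁ L₂) Θ j (dy φ))

/-- `Θ ∈ H¹(Ω)²`: the weak derivatives `Θ_x` and `Θ_y` exist in `L²(Ω)²`. -/
def IsH1 (Θ : L2Vec L₁ L₂) : Prop :=
  (∃ G, IsWeakImage 1 0 Θ G) ∧ (∃ G, IsWeakImage 0 1 Θ G)

/-- Abstract form of the vanishing of the trace of the component `θᵢ` on one side of `Ω`: the
averages of `θᵢ` over the strips of width `ε` along that side tend to zero as distributions of the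
tangential coordinate `τ ∈ (0, ℓ)`. -/
def ZeroTraceAlong (strip : ℝ → Set (ℝ × ℝ)) (τ : ℝ × ℝ → ℝ) (ℓ : ℝ)
    (Θ : L2Vec L₁ L₂) (i : Fin 2) : Prop :=
  ∀ φ : ℝ → ℝ, IsTestFunction (Ioo 0 ℓ) φ →
    Tendsto (fun ε : ℝ => ε⁻¹ * pairing (rect L₁ L₂ ∩ strip ε) Θ i (fun p => φ (τ p)))
      (𝓝[>] 0) (𝓝 0)

/-- `θᵢ = 0` on the side `Γ_W = {x = 0}`. -/
def ZeroOnWest (Θ : L2Vec L₁ L₂) (i : Fin 2) : Prop :=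
  ZeroTraceAlong (fun ε => {p | p.1 < ε}) Prod.snd L₂ Θ i

/-- `θᵢ = 0` on the side `Γ_E = {x = L₁}`. -/
def ZeroOnEast (Θ : L2Vec L₁ L₂) (i : Fin 2) : Prop :=
  ZeroTraceAlong (fun ε => {p | L₁ - ε < p.1}) Prod.snd L₂ Θ i

/-- `θᵢ = 0` on the side `Γ_S = {y = 0}`. -/
def ZeroOnSouth (Θ : L2Vec L₁ L₂) (i : Fin 2) : Prop :=
  ZeroTraceAlong (fun ε => {p | p.2 < ε}) Prod.fst L₁ Θ i

/-- `θᵢ = 0` on the side `Γ_N = {y = L₂}`. -/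
def ZeroOnNorth (Θ : L2Vec L₁ L₂) (i : Fin 2) : Prop :=
  ZeroTraceAlong (fun ε => {p | L₂ - ε < p.2}) Prod.fst L₁ Θ i

/-- The mixed boundary conditions: the first component vanishes on `Γ_W ∪ Γ_S`, the second one on
the complementary part `Γ_E ∪ Γ_N` of the boundary. -/
def MixedBC (Θ : L2Vec L₁ L₂) : Prop :=
  ZeroOnWest Θ 0 ∧ ZeroOnSouth Θ 0 ∧ ZeroOnEast Θ 1 ∧ ZeroOnNorth Θ 1

/-- The coefficient matrix with rows `(a, b)` and `(b, -a)`. -/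
def coeff (a b : ℝ) : Matrix (Fin 2) (Fin 2) ℝ := !![a, b; b, -a]

/-! Elementary facts that the construction of the operators needs. -/

instance : IsFiniteMeasure ((volume : Measure (ℝ × ℝ)).restrict (rect L₁ L₂)) := by
  refine ⟨?_⟩
  rw [Measure.restrict_apply_univ]
  refine lt_of_le_of_lt (measure_mono (t := Icc 0 L₁ ×ˢ Icc 0 L₂) ?_)
    (isCompact_Icc.prod isCompact_Icc).measure_lt_top
  exact prod_mono Ioo_subset_Icc_self Ioo_subset_Icc_self

lemma integrable_comp (Θ : L2Vec L₁ L₂) (i : Fin 2) :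
    Integrable (fun p => (Θ p) i) ((volume : Measure (ℝ × ℝ)).restrict (rect L₁ L₂)) :=
  ((EuclideanSpace.proj i : EuclideanSpace ℝ (Fin 2) →L[ℝ] ℝ).integrable_comp
    ((Lp.memLp Θ).integrable (by norm_num)))

lemma integrableOn_pairing {S : Set (ℝ × ℝ)} (hS : S ⊆ rect L₁ L₂) (Θ : L2Vec L₁ L₂) (i : Fin 2)
    {g : ℝ × ℝ → ℝ} (hg : Continuous g) :
    IntegrableOn (fun p => (Θ p) i * g p) S := by
  have hK : IsCompact (Icc 0 L₁ ×ˢ Icc 0 L₂ : Set (ℝ × ℝ)) := isCompact_Icc.prod isCompact_Icc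
  obtain ⟨C, hC⟩ := hK.exists_bound_of_continuousOn hg.continuousOn
  have h : IntegrableOn (fun p => (Θ p) i * g p) (rect L₁ L₂) := by
    refine (integrable_comp Θ i).mul_bdd (c := C) hg.aestronglyMeasurable ?_
    refine (ae_restrict_iff' (measurableSet_Ioo.prod measurableSet_Ioo)).2 (ae_of_all _ ?_)
    exact fun p hp => hC p (prod_mono Ioo_subset_Icc_self Ioo_subset_Icc_self hp)
  exact h.mono_set hS

lemma pairing_add {S : Set (ℝ × ℝ)} (hS : S ⊆ rect L₁ L₂) (Θ Ψ : L2Vec L₁ L₂) (i : Fin 2)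
    {g : ℝ × ℝ → ℝ} (hg : Continuous g) :
    pairing S (Θ + Ψ) i g = pairing S Θ i g + pairing S Ψ i g := by
  unfold pairing
  rw [← integral_add (integrableOn_pairing hS Θ i hg) (integrableOn_pairing hS Ψ i hg)]
  refine integral_congr_ae ?_
  filter_upwards [ae_restrict_of_ae_restrict_of_subset hS (Lp.coeFn_add Θ Ψ)] with p hp
  rw [hp]
  simp [add_mul]

lemma pairing_smul {S : Set (ℝ × ℝ)} (hS : S ⊆ rect L₁ L₂) (c : ℝ) (Θ : L2Vec L₁ L₂) (i : Fin 2)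
    (g : ℝ × ℝ → ℝ) :
    pairing S (c • Θ) i g = c * pairing S Θ i g := by
  unfold pairing
  rw [← integral_const_mul]
  refine integral_congr_ae ?_
  filter_upwards [ae_restrict_of_ae_restrict_of_subset hS (Lp.coeFn_smul c Θ)] with p hp
  simp [hp, mul_assoc]

lemma IsTestFunction.continuous_dx {U : Set (ℝ × ℝ)} {φ : ℝ × ℝ → ℝ} (h : IsTestFunction U φ) :
    Continuous (dx φ) :=
  (h.1.continuous_fderiv (by simp)).clm_apply continuous_const

lemma IsTestFunction.continuous_dy {U : Set (ℝ × ℝ)} {φ : ℝ × ℝ → ℝ} (h : IsTestFunction U φ) :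
    Continuous (dy φ) :=
  (h.1.continuous_fderiv (by simp)).clm_apply continuous_const

section linearity

variable {A B : Matrix (Fin 2) (Fin 2) ℝ} {Θ Ψ F G : L2Vec L₁ L₂}

lemma IsWeakImage.add (h : IsWeakImage A B Θ F) (h' : IsWeakImage A B Ψ G) :
    IsWeakImage A B (Θ + Ψ) (F + G) := by
  intro φ hφ i
  simp only [pairing_add subset_rfl _ _ _ hφ.1.continuous,
    pairing_add subset_rfl _ _ _ hφ.continuous_dx, pairing_add subset_rfl _ _ _ hφ.continuous_dy,
    h φ hφ i, h' φ hφ i, Fin.sum_univ_two]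
  ring

lemma IsWeakImage.smul (c : ℝ) (h : IsWeakImage A B Θ F) :
    IsWeakImage A B (c • Θ) (c • F) := by
  intro φ hφ i
  simp only [pairing_smul subset_rfl, h φ hφ i, Fin.sum_univ_two]
  ring

/-- The image in the sense of distributions is unique. -/
lemma IsWeakImage.unique (h : IsWeakImage A B Θ F) (h' : IsWeakImage A B Θ G) : F = G := by
  have hO : IsOpen (rect L₁ L₂) := isOpen_Ioo.prod isOpen_Ioo
  have key : ∀ i : Fin 2, ∀ᵐ p ∂((volume : Measure (ℝ × ℝ)).restrict (rect L₁ L₂)),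
      (F p) i = (G p) i := by
    intro i
    have hloc : LocallyIntegrableOn (fun p => (F p) i - (G p) i) (rect L₁ L₂) volume :=
      IntegrableOn.locallyIntegrableOn ((integrable_comp F i).sub (integrable_comp G i))
    have h0 := hO.ae_eq_zero_of_integral_contDiff_smul_eq_zero hloc (fun φ h1 h2 h3 => by
      have e := (h φ ⟨h1, h2, h3⟩ i).trans (h' φ ⟨h1, h2, h3⟩ i).symm
      unfold pairing at e
      rw [← sub_eq_zero, ← integral_sub (integrableOn_pairing subset_rfl F i h1.continuous)
        (integrableOn_pairing subset_rfl G i h1.continuous)] at e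
      rw [← e, ← setIntegral_eq_integral_of_forall_compl_eq_zero (s := rect L₁ L₂)]
      · refine integral_congr_ae (ae_of_all _ fun p => ?_)
        simp only [smul_eq_mul]
        ring
      · intro p hp
        have : φ p = 0 := image_eq_zero_of_notMem_tsupport fun hh => hp (h3 hh)
        simp [this])
    refine (ae_restrict_iff' hO.measurableSet).2 ?_
    filter_upwards [h0] with p hp hpΩ using sub_eq_zero.1 (hp hpΩ)
  refine Lp.ext ?_
  filter_upwards [key 0, key 1] with p h0 h1
  ext i
  fin_cases i
  · exact h0
  · exact h1

lemma ZeroTraceAlong.add {strip : ℝ → Set (ℝ × ℝ)} {τ : ℝ × ℝ → ℝ} (hτ : Continuous τ) {ℓ : ℝ}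
    {i : Fin 2} (h : ZeroTraceAlong strip τ ℓ Θ i) (h' : ZeroTraceAlong strip τ ℓ Ψ i) :
    ZeroTraceAlong strip τ ℓ (Θ + Ψ) i := by
  intro φ hφ
  have e := (h φ hφ).add (h' φ hφ)
  simp only [add_zero, ← mul_add] at e
  refine e.congr fun ε => ?_
  rw [pairing_add (g := fun p => φ (τ p)) inter_subset_left _ _ _ (hφ.1.continuous.comp hτ)]

lemma ZeroTraceAlong.smul {strip : ℝ → Set (ℝ × ℝ)} {τ : ℝ × ℝ → ℝ} {ℓ : ℝ} (c : ℝ)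
    {i : Fin 2} (h : ZeroTraceAlong strip τ ℓ Θ i) :
    ZeroTraceAlong strip τ ℓ (c • Θ) i := by
  intro φ hφ
  have e := (h φ hφ).const_mul c
  simp only [mul_zero] at e
  refine e.congr fun ε => ?_
  rw [pairing_smul inter_subset_left]
  ring

lemma MixedBC.add (h : MixedBC Θ) (h' : MixedBC Ψ) : MixedBC (Θ + Ψ) :=
  ⟨h.1.add continuous_snd h'.1, h.2.1.add continuous_fst h'.2.1,
    h.2.2.1.add continuous_snd h'.2.2.1, h.2.2.2.add continuous_fst h'.2.2.2⟩

lemma MixedBC.smul (c : ℝ) (h : MixedBC Θ) : MixedBC (c • Θ) :=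
  ⟨ZeroTraceAlong.smul c h.1, ZeroTraceAlong.smul c h.2.1, ZeroTraceAlong.smul c h.2.2.1,
    ZeroTraceAlong.smul c h.2.2.2⟩

lemma mixedBC_zero : MixedBC (0 : L2Vec L₁ L₂) := by
  have h : ∀ (strip : ℝ → Set (ℝ × ℝ)) (τ : ℝ × ℝ → ℝ) (ℓ : ℝ) (i : Fin 2),
      ZeroTraceAlong strip τ ℓ (0 : L2Vec L₁ L₂) i := fun strip τ ℓ i φ _ => by
    have e : ∀ ε : ℝ, pairing (rect L₁ L₂ ∩ strip ε) (0 : L2Vec L₁ L₂) i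
        (fun p => φ (τ p)) = 0 := fun ε => by
      have := pairing_smul (inter_subset_left (s := rect L₁ L₂) (t := strip ε)) 0
        (0 : L2Vec L₁ L₂) i (fun p => φ (τ p))
      simpa using this
    simp [e]
  exact ⟨h _ _ _ _, h _ _ _ _, h _ _ _ _, h _ _ _ _⟩

lemma isWeakImage_zero : IsWeakImage A B (0 : L2Vec L₁ L₂) 0 := by
  intro φ _ i
  have e : ∀ (j : Fin 2) (g : ℝ × ℝ → ℝ), pairing (rect L₁ L₂) (0 : L2Vec L₁ L₂) j g = 0 :=
    fun j g => by simpa using pairing_smul (subset_refl (rect L₁ L₂)) 0 (0 : L2Vec L₁ L₂) j g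
  simp [e]

/-- For `Θ ∈ H¹(Ω)²` one has `A Θ_x + B Θ_y ∈ L²(Ω)²`. -/
lemma IsH1.exists_isWeakImage (A B : Matrix (Fin 2) (Fin 2) ℝ) (h : IsH1 Θ) :
    ∃ F, IsWeakImage A B Θ F := by
  obtain ⟨⟨X, hX⟩, Y, hY⟩ := h
  have hm : ∀ (M : Matrix (Fin 2) (Fin 2) ℝ) (Z : L2Vec L₁ L₂) (φ : ℝ × ℝ → ℝ) (i : Fin 2),
      Continuous φ → pairing (rect L₁ L₂) ((Matrix.toEuclideanCLM (𝕜 := ℝ) M).compLp Z) i φ =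
        ∑ j : Fin 2, M i j * pairing (rect L₁ L₂) Z j φ := by
    intro M Z φ i hφ
    unfold pairing
    simp only [← integral_const_mul]
    rw [← integral_finsetSum _ fun j _ =>
      (integrableOn_pairing subset_rfl Z j hφ).const_mul (M i j)]
    refine integral_congr_ae ?_
    filter_upwards [ContinuousLinearMap.coeFn_compLp (Matrix.toEuclideanCLM (𝕜 := ℝ) M) Z]
      with p hp
    simp [hp, Matrix.mulVec, dotProduct, Fin.sum_univ_two]
    ring
  refine ⟨(Matrix.toEuclideanCLM (𝕜 := ℝ) A).compLp X +
    (Matrix.toEuclideanCLM (𝕜 := ℝ) B).compLp Y, fun φ hφ i => ?_⟩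
  rw [pairing_add subset_rfl _ _ _ hφ.1.continuous, hm A X φ i hφ.1.continuous,
    hm B Y φ i hφ.1.continuous]
  have x0 := hX φ hφ 0
  have x1 := hX φ hφ 1
  have y0 := hY φ hφ 0
  have y1 := hY φ hφ 1
  simp only [Fin.sum_univ_two, Matrix.one_apply_eq, Matrix.zero_apply, ne_eq, zero_ne_one,
    one_ne_zero, not_false_eq_true, Matrix.one_apply_ne, zero_mul, one_mul, add_zero,
    zero_add] at x0 x1 y0 y1
  simp only [Fin.sum_univ_two, x0, x1, y0, y1]
  ring

end linearity

/-- `V`: the fields of `H¹(Ω)²` that satisfy the mixed boundary conditions. -/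
def V (L₁ L₂ : ℝ) : Submodule ℝ (L2Vec L₁ L₂) where
  carrier := {Θ | IsH1 Θ ∧ MixedBC Θ}
  zero_mem' := ⟨⟨⟨0, isWeakImage_zero⟩, ⟨0, isWeakImage_zero⟩⟩, mixedBC_zero⟩
  add_mem' := by
    rintro Θ Ψ ⟨⟨⟨X, hX⟩, Y, hY⟩, hb⟩ ⟨⟨⟨X', hX'⟩, Y', hY'⟩, hb'⟩
    exact ⟨⟨⟨_, hX.add hX'⟩, ⟨_, hY.add hY'⟩⟩, hb.add hb'⟩
  smul_mem' := by
    rintro c Θ ⟨⟨⟨X, hX⟩, Y, hY⟩, hb⟩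
    exact ⟨⟨⟨_, hX.smul c⟩, ⟨_, hY.smul c⟩⟩, hb.smul c⟩

/-- The fields `Θ ∈ L²(Ω)²` with `A Θ_x + B Θ_y ∈ L²(Ω)²` (in the sense of distributions) that
satisfy the mixed boundary conditions. -/
def maximalDomain (L₁ L₂ : ℝ) (A B : Matrix (Fin 2) (Fin 2) ℝ) : Submodule ℝ (L2Vec L₁ L₂) where
  carrier := {Θ | (∃ F, IsWeakImage A B Θ F) ∧ MixedBC Θ}
  zero_mem' := ⟨⟨0, isWeakImage_zero⟩, mixedBC_zero⟩
  add_mem' := by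
    rintro Θ Ψ ⟨⟨F, hF⟩, hb⟩ ⟨⟨G, hG⟩, hb'⟩
    exact ⟨⟨_, hF.add hG⟩, hb.add hb'⟩
  smul_mem' := by
    rintro c Θ ⟨⟨F, hF⟩, hb⟩
    exact ⟨⟨_, hF.smul c⟩, hb.smul c⟩

lemma V_le_maximalDomain (A B : Matrix (Fin 2) (Fin 2) ℝ) : V L₁ L₂ ≤ maximalDomain L₁ L₂ A B :=
  fun _ h => ⟨h.1.exists_isWeakImage A B, h.2⟩

/-- The operator `Θ ↦ T₁ Θ_x + T₂ Θ_y` in `L²(Ω)²`, where `T₁ = (α₁, β₁; β₁, -α₁)` and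
`T₂ = (α₂, β₂; β₂, -α₂)`, with the maximal domain
`{Θ ∈ L²(Ω)² | T₁ Θ_x + T₂ Θ_y ∈ L²(Ω)², Θ satisfies the mixed boundary conditions}`. -/
def opTMax (L₁ L₂ α₁ α₂ β₁ β₂ : ℝ) : L2Vec L₁ L₂ →ₗ.[ℝ] L2Vec L₁ L₂ where
  domain := maximalDomain L₁ L₂ (coeff α₁ β₁) (coeff α₂ β₂)
  toFun :=
    { toFun := fun Θ => Θ.2.1.choose
      map_add' := fun Θ Ψ =>
        (Θ + Ψ).2.1.choose_spec.unique (Θ.2.1.choose_spec.add Ψ.2.1.choose_spec)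
      map_smul' := fun c Θ => (c • Θ).2.1.choose_spec.unique (Θ.2.1.choose_spec.smul c) }

/-- The operator `𝒯 Θ = T₁ Θ_x + T₂ Θ_y` in `L²(Ω)²` with domain `𝒟(𝒯) = V`. -/
def opT (L₁ L₂ α₁ α₂ β₁ β₂ : ℝ) : L2Vec L₁ L₂ →ₗ.[ℝ] L2Vec L₁ L₂ where
  domain := V L₁ L₂
  toFun := (opTMax L₁ L₂ α₁ α₂ β₁ β₂).toFun.comp (Submodule.inclusion (V_le_maximalDomain _ _))

/-- The values of `𝒯` are the distributions `T₁ Θ_x + T₂ Θ_y`. -/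
lemma opT_spec (L₁ L₂ α₁ α₂ β₁ β₂ : ℝ) (Θ : (opT L₁ L₂ α₁ α₂ β₁ β₂).domain) :
    IsWeakImage (coeff α₁ β₁) (coeff α₂ β₂) (Θ : L2Vec L₁ L₂) (opT L₁ L₂ α₁ α₂ β₁ β₂ Θ) :=
  ((Submodule.inclusion (V_le_maximalDomain _ _) Θ :
    maximalDomain L₁ L₂ (coeff α₁ β₁) (coeff α₂ β₂))).2.1.choose_spec

end EllipticMode

end

/-! Let `J` and `K` be the operators `∫₀ˣ` and `∫₀ʸ` on `L²(Ω)`. They are bounded and they commute;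
their adjoints are the integrals from `x` to `L₁` and from `y` to `L₂`. The fundamental theorem of
calculus turns the boundary conditions into algebra: `Θ ∈ V` exactly when `θ₁ = J X = K Y` and `θ₂ =
J* X' = K* Y'`, with `X, Y` the derivatives of `θ₁` and `X', Y'` minus the derivatives of `θ₂`
(`exists_isPrimitive_of_mem_V`, `IsPrimitive.mem_V`). Then `𝒯Θ` has components `α₁X + α₂Y - β₁X' -
β₂Y'` and `β₁X + β₂Y + α₁X' + α₂Y'`.

Positivity: in `⟪𝒯Θ, Θ⟫` the `β` terms cancel because `⟪X', J X⟫ = ⟪X, J* X'⟫`, and likewise for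
`K`. What remains is a combination of forms `⟪J X, X⟫` and `⟪K Y, Y⟫` with coefficients `α₁, α₂`.
These are nonnegative, since `J + J*` integrates over a whole line and its form is an integral of
squares.

Surjectivity (`exists_opT_eq`): as the determinant is nonzero, `F = p + z` can be read as the `(X,
Y)` part `p` plus the `(X', Y')` part `z` of the formula for `𝒯Θ`. The constraints `J X = K Y` and
`J* X' = K* Y'` become `A p = 0` and `B z = 0`. Commutation gives `B A* = 0`, so `(ker A)ᗮ`, the
closure of the range of `A*`, lies in `ker B`, and the orthogonal splitting along `ker A` solves the
equation.

Adjoints (`inner_adjoint_self_nonneg`): if `T` extends `𝒯` and `Ψ ∈ 𝒟(T*)`, choose `Θ ∈ V` with `𝒯Θ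
= T*Ψ`. Then `⟪T*Ψ, Ψ⟫ = ⟪TΘ, Ψ⟫ = ⟪Θ, T*Ψ⟫ = ⟪Θ, 𝒯Θ⟫ ≥ 0`. No description of `𝒟(T*)` is needed, and
`T = 𝒯` and `T = 𝒯_max` are treated alike. -/

noncomputable section

namespace EllipticMode

/-! ### Integral operators in one variable on `L²` of a product -/

section fiber

variable {α β : Type*} [MeasurableSpace α] [MeasurableSpace β]
  {μ : Measure α} {ν : Measure β} [IsFiniteMeasure μ] [IsFiniteMeasure ν]
  {m : Measure (α × β)} {k : α → α → ℝ} {f g : α × β → ℝ}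

/-- Partial integration in the first variable against the kernel `k`. -/
def fiberIntegral (μ : Measure α) (k : α → α → ℝ) (f : α × β → ℝ) (p : α × β) : ℝ :=
  ∫ s, k p.1 s * f (s, p.2) ∂μ

lemma ae_ae_of_ae_prod_swap {P : α × β → Prop} (h : ∀ᵐ p ∂(μ.prod ν), P p) :
    ∀ᵐ y ∂ν, ∀ᵐ x ∂μ, P (x, y) := by
  rw [← Measure.prod_swap] at h
  exact Measure.ae_ae_of_ae_prod (ae_of_ae_map measurable_swap.aemeasurable h)

lemma ae_prod_of_ae_snd {P : β → Prop} (h : ∀ᵐ y ∂ν, P y) : ∀ᵐ p ∂(μ.prod ν), P p.2 :=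
  Measure.quasiMeasurePreserving_snd.ae h

lemma fiberIntegral_congr (k : α → α → ℝ) (h : f =ᵐ[μ.prod ν] g) :
    fiberIntegral μ k f =ᵐ[μ.prod ν] fiberIntegral μ k g := by
  filter_upwards [ae_prod_of_ae_snd (μ := μ) (ae_ae_of_ae_prod_swap h)] with p hp
  refine integral_congr_ae ?_
  filter_upwards [hp] with s hs
  rw [hs]

/-- Measurable kernels bounded by one. -/
structure IsKernel (k : α → α → ℝ) : Prop where
  measurable : Measurable (Function.uncurry k)
  abs_le : ∀ x s, |k x s| ≤ 1

lemma IsKernel.swap (hk : IsKernel k) : IsKernel (fun x s => k s x) :=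
  ⟨hk.measurable.comp measurable_swap, fun x s => hk.abs_le s x⟩

lemma aestronglyMeasurable_fiberIntegral (hk : IsKernel k)
    (hf : AEStronglyMeasurable f (μ.prod ν)) :
    AEStronglyMeasurable (fiberIntegral μ k f) (μ.prod ν) := by
  refine AEStronglyMeasurable.congr ?_ (fiberIntegral_congr k hf.ae_eq_mk).symm
  refine StronglyMeasurable.aestronglyMeasurable ?_
  refine StronglyMeasurable.integral_prod_right'
    (f := fun q : (α × β) × α => k q.1.1 q.2 * hf.mk f (q.2, q.1.2)) ?_
  refine StronglyMeasurable.mul ?_ ?_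
  · exact (hk.measurable.comp
      ((measurable_fst.comp measurable_fst).prodMk measurable_snd)).stronglyMeasurable
  · exact hf.stronglyMeasurable_mk.comp_measurable
      (measurable_snd.prodMk (measurable_snd.comp measurable_fst))

lemma IsKernel.integrable_mul (hk : IsKernel k) (x : α) {h : α → ℝ} (hh : Integrable h μ) :
    Integrable (fun s => k x s * h s) μ :=
  hh.bdd_mul (c := 1) (hk.measurable.comp measurable_prodMk_left).aestronglyMeasurable
    (ae_of_all _ fun s => hk.abs_le x s)

lemma integrable_mul_of_memLp_two {γ : Type*} [MeasurableSpace γ] {ρ : Measure γ} {f g : γ → ℝ}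
    (hf : MemLp f 2 ρ) (hg : MemLp g 2 ρ) : Integrable (fun p => f p * g p) ρ :=
  hf.integrable_mul hg

/-- Cauchy–Schwarz against the constant `1`, obtained by expanding `∫ (C h - M)² ≥ 0`, where `C` is
the total mass and `M = ∫ h`; dividing by `C` leaves the case `C = 0`, in which the measure
vanishes. -/
lemma sq_integral_le {h : α → ℝ} (hh : MemLp h 2 μ) :
    (∫ s, h s ∂μ) ^ 2 ≤ μ.real univ * ∫ s, h s ^ 2 ∂μ := by
  set M := ∫ s, h s ∂μ
  set C := μ.real univ with hC
  have h1 : Integrable h μ := hh.integrable (by norm_num)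
  have h2 : Integrable (fun s => h s ^ 2) μ := hh.integrable_sq
  have h3 : 0 ≤ ∫ s, (C * h s - M) ^ 2 ∂μ := integral_nonneg fun s => sq_nonneg _
  have h4 : ∫ s, (C * h s - M) ^ 2 ∂μ = C * (C * ∫ s, h s ^ 2 ∂μ - M ^ 2) := by
    have e : ∀ s, (C * h s - M) ^ 2 = C ^ 2 * h s ^ 2 - 2 * C * M * h s + M ^ 2 := fun s => by ring
    simp only [e]
    have h5 : Integrable (fun s => C ^ 2 * h s ^ 2 - 2 * C * M * h s) μ :=
      (h2.const_mul _).sub (h1.const_mul _)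
    rw [integral_add h5 (integrable_const _),
      integral_sub (h2.const_mul _) (h1.const_mul _), integral_const_mul, integral_const_mul,
      integral_const]
    simp only [smul_eq_mul, ← hC]
    change C ^ 2 * _ - 2 * C * M * M + C * M ^ 2 = _
    ring
  rw [h4] at h3
  rcases (measureReal_nonneg : 0 ≤ C).eq_or_lt with h0 | h0
  · have : μ = 0 := by
      rw [← Measure.measure_univ_eq_zero]
      exact (measureReal_eq_zero_iff).1 (hC ▸ h0.symm)
    simp [M, this]
  · have := nonneg_of_mul_nonneg_right h3 h0
    linarith

lemma MemLp.fiber (hf : MemLp f 2 (μ.prod ν)) : ∀ᵐ y ∂ν, MemLp (fun x => f (x, y)) 2 μ := by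
  have h1 : ∀ᵐ y ∂ν, AEStronglyMeasurable (fun x => f (x, y)) μ :=
    (hf.integrable (by norm_num)).prod_left_ae.mono fun y hy => hy.1
  filter_upwards [h1, hf.integrable_sq.prod_left_ae] with y h1 h2
  exact (memLp_two_iff_integrable_sq h1).2 h2

lemma sq_fiberIntegral_le (hk : IsKernel k) (hf : MemLp f 2 (μ.prod ν)) :
    ∀ᵐ p ∂(μ.prod ν), fiberIntegral μ k f p ^ 2 ≤
      μ.real univ * ∫ s, f (s, p.2) ^ 2 ∂μ := by
  filter_upwards [ae_prod_of_ae_snd (μ := μ) (MemLp.fiber hf)] with p hp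
  have hm : MemLp (fun s => k p.1 s * f (s, p.2)) 2 μ := by
    refine hp.of_le (hk.integrable_mul p.1 (hp.integrable (by norm_num))).1
      (ae_of_all _ fun s => ?_)
    rw [norm_mul]
    exact mul_le_of_le_one_left (norm_nonneg _) (hk.abs_le _ _)
  refine (sq_integral_le hm).trans ?_
  refine mul_le_mul_of_nonneg_left ?_ measureReal_nonneg
  refine integral_mono hm.integrable_sq hp.integrable_sq fun s => ?_
  rw [mul_pow]
  refine mul_le_of_le_one_left (sq_nonneg _) ?_
  rw [sq_le_one_iff_abs_le_one]
  exact hk.abs_le _ _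

lemma integrable_integral_sq_snd (hf : MemLp f 2 (μ.prod ν)) :
    Integrable (fun p : α × β => ∫ s, f (s, p.2) ^ 2 ∂μ) (μ.prod ν) :=
  (hf.integrable_sq.integral_prod_right).comp_snd μ

lemma memLp_fiberIntegral (hk : IsKernel k) (hf : MemLp f 2 (μ.prod ν)) :
    MemLp (fiberIntegral μ k f) 2 (μ.prod ν) := by
  have hm := aestronglyMeasurable_fiberIntegral hk hf.1
  refine (memLp_two_iff_integrable_sq hm).2 ?_
  refine ((integrable_integral_sq_snd hf).const_mul (μ.real univ)).mono (hm.pow 2) ?_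
  filter_upwards [sq_fiberIntegral_le hk hf] with p hp
  rw [Real.norm_of_nonneg (sq_nonneg _)]
  exact hp.trans (le_abs_self _)

lemma integral_sq_fiberIntegral_le (hk : IsKernel k) (hf : MemLp f 2 (μ.prod ν)) :
    ∫ p, fiberIntegral μ k f p ^ 2 ∂(μ.prod ν) ≤
      μ.real univ ^ 2 * ∫ p, f p ^ 2 ∂(μ.prod ν) := by
  refine (integral_mono_ae (memLp_fiberIntegral hk hf).integrable_sq
    ((integrable_integral_sq_snd hf).const_mul (μ.real univ)) (sq_fiberIntegral_le hk hf)).trans ?_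
  rw [integral_const_mul, integral_prod_symm _ hf.integrable_sq,
    integral_fun_snd (μ := μ) (ν := ν) (fun y => ∫ s, f (s, y) ^ 2 ∂μ)]
  simp only [smul_eq_mul]
  exact le_of_eq (by ring)

lemma norm_sq_eq_integral (F : Lp ℝ 2 m) : ‖F‖ ^ 2 = ∫ p, F p ^ 2 ∂m := by
  rw [← real_inner_self_eq_norm_sq, L2.inner_def]
  simp only [real_inner_self_eq_norm_sq, Real.norm_eq_abs, sq_abs]

/-- Partial integration in the first variable against `k`, as an operator on `L²(μ × ν)`. -/
def fiberOp (hm : m = μ.prod ν) (hk : IsKernel k) : Lp ℝ 2 m →L[ℝ] Lp ℝ 2 m :=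
  LinearMap.mkContinuous
    { toFun := fun F => MemLp.toLp (fiberIntegral μ k F)
        -- The product structure enters through the equation `hm`, because Lebesgue measure on
        -- `rect` is a product only by the theorem `restrict_rect`.
        (by subst hm; exact memLp_fiberIntegral hk (Lp.memLp F))
      map_add' := fun F G => by
        subst hm
        rw [← MemLp.toLp_add]
        refine MemLp.toLp_congr _ _ ?_
        refine (fiberIntegral_congr k (Lp.coeFn_add F G)).trans ?_
        filter_upwards [ae_prod_of_ae_snd (μ := μ) (MemLp.fiber (Lp.memLp F)),
          ae_prod_of_ae_snd (μ := μ) (MemLp.fiber (Lp.memLp G))] with p hF hG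
        simp only [fiberIntegral, Pi.add_apply, mul_add]
        exact integral_add (hk.integrable_mul _ (hF.integrable (by norm_num)))
          (hk.integrable_mul _ (hG.integrable (by norm_num)))
      map_smul' := fun c F => by
        subst hm
        rw [RingHom.id_apply, ← MemLp.toLp_const_smul]
        refine MemLp.toLp_congr _ _ ?_
        refine (fiberIntegral_congr k (Lp.coeFn_smul c F)).trans (ae_of_all _ fun p => ?_)
        simp only [fiberIntegral, Pi.smul_apply, smul_eq_mul, ← integral_const_mul]
        exact integral_congr_ae (ae_of_all _ fun s => by ring) }
    (μ.real univ) fun F => by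
      subst hm
      refine abs_le_of_sq_le_sq' ?_ (by positivity) |>.2
      rw [mul_pow, norm_sq_eq_integral, norm_sq_eq_integral]
      refine le_trans (le_of_eq ?_) (integral_sq_fiberIntegral_le hk (Lp.memLp F))
      refine integral_congr_ae ?_
      filter_upwards [MemLp.coeFn_toLp (memLp_fiberIntegral hk (Lp.memLp F))] with p hp
      exact congrArg (· ^ 2) hp

lemma coeFn_fiberOp (hm : m = μ.prod ν) (hk : IsKernel k) (F : Lp ℝ 2 m) :
    fiberOp hm hk F =ᵐ[m] fiberIntegral μ k F :=
  MemLp.coeFn_toLp (by subst hm; exact memLp_fiberIntegral hk (Lp.memLp F))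

/-- Fubini on each line `y = const`: exchanging the two integrations transposes the kernel. This
identifies the adjoint of `fiberOp`. -/
lemma integral_fiberIntegral_mul (hk : IsKernel k) (hf : MemLp f 2 (μ.prod ν))
    (hg : MemLp g 2 (μ.prod ν)) :
    ∫ p, fiberIntegral μ k f p * g p ∂(μ.prod ν) =
      ∫ p, f p * fiberIntegral μ (fun x s => k s x) g p ∂(μ.prod ν) := by
  rw [integral_prod_symm _ (integrable_mul_of_memLp_two (memLp_fiberIntegral hk hf) hg),
    integral_prod_symm _ (integrable_mul_of_memLp_two hf (memLp_fiberIntegral hk.swap hg))]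
  refine integral_congr_ae ?_
  filter_upwards [MemLp.fiber hf, MemLp.fiber hg] with y hfy hgy
  simp only [fiberIntegral, ← integral_const_mul, ← integral_mul_const]
  have hfi := hfy.integrable (by norm_num : (1 : ENNReal) ≤ 2)
  have hgi := hgy.integrable (by norm_num : (1 : ENNReal) ≤ 2)
  rw [integral_integral_swap]
  · refine integral_congr_ae (ae_of_all _ fun s => integral_congr_ae (ae_of_all _ fun x => ?_))
    simp only
    ring
  · refine ((hgi.mul_prod hfi).bdd_mul (c := 1) hk.measurable.aestronglyMeasurable
      (ae_of_all _ fun q => hk.abs_le q.1 q.2)).congr (ae_of_all _ fun q => ?_)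
    simp only [Function.uncurry]
    ring

lemma inner_eq_integral (F G : Lp ℝ 2 m) : inner ℝ F G = ∫ p, F p * G p ∂m := by
  rw [L2.inner_def]
  refine integral_congr_ae (ae_of_all _ fun p => ?_)
  simp [mul_comm]

lemma adjoint_fiberOp (hm : m = μ.prod ν) (hk : IsKernel k) :
    ContinuousLinearMap.adjoint (fiberOp hm hk) = fiberOp hm hk.swap := by
  refine ((ContinuousLinearMap.eq_adjoint_iff _ _).2 fun F G => ?_).symm
  rw [inner_eq_integral, inner_eq_integral]
  subst hm
  have e1 : ∫ p, fiberOp rfl hk.swap F p * G p ∂(μ.prod ν) =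
      ∫ p, fiberIntegral μ (fun x s => k s x) F p * G p ∂(μ.prod ν) := by
    refine integral_congr_ae ?_
    filter_upwards [coeFn_fiberOp rfl hk.swap F] with p hp
    rw [hp]
  have e2 : ∫ p, F p * fiberOp rfl hk G p ∂(μ.prod ν) =
      ∫ p, F p * fiberIntegral μ k G p ∂(μ.prod ν) := by
    refine integral_congr_ae ?_
    filter_upwards [coeFn_fiberOp rfl hk G] with p hp
    rw [hp]
  rw [e1, e2]
  exact integral_fiberIntegral_mul hk.swap (Lp.memLp F) (Lp.memLp G)

/-- If `k(x, s) + k(s, x) = 1` almost everywhere, integration against `k` is monotone. -/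
lemma inner_fiberOp_self_nonneg (hm : m = μ.prod ν) (hk : IsKernel k)
    (h1 : ∀ x, ∀ᵐ s ∂μ, k x s + k s x = 1) (F : Lp ℝ 2 m) :
    0 ≤ inner ℝ (fiberOp hm hk F) F := by
  -- Adding the transposed kernel replaces `k` by the constant `1`, up to a null set on each line.
  have key : inner ℝ (fiberOp hm hk F) F + inner ℝ (fiberOp hm hk.swap F) F =
      ∫ p, fiberIntegral μ (fun _ _ => 1) F p * F p ∂m := by
    rw [← inner_add_left, inner_eq_integral]
    subst hm
    refine integral_congr_ae ?_
    filter_upwards [coeFn_fiberOp rfl hk F, coeFn_fiberOp rfl hk.swap F,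
      Lp.coeFn_add (fiberOp rfl hk F) (fiberOp rfl hk.swap F),
      ae_prod_of_ae_snd (μ := μ) (MemLp.fiber (Lp.memLp F))] with p e1 e2 e3 hp
    rw [e3, Pi.add_apply, e1, e2]
    congr 1
    have hi := hp.integrable (by norm_num : (1 : ENNReal) ≤ 2)
    simp only [fiberIntegral]
    rw [← integral_add (hk.integrable_mul _ hi) (hk.swap.integrable_mul _ hi)]
    refine integral_congr_ae ?_
    filter_upwards [h1 p.1] with s hs
    rw [← add_mul, hs]
  have hsym : inner ℝ (fiberOp hm hk.swap F) F = inner ℝ (fiberOp hm hk F) F := by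
    rw [← adjoint_fiberOp, ContinuousLinearMap.adjoint_inner_left, real_inner_comm]
  -- The form of the kernel `1` is the integral over `y` of `(∫ F(x, y) dx)²`.
  have hpos : 0 ≤ ∫ p, fiberIntegral μ (fun _ _ => 1) F p * F p ∂m := by
    subst hm
    have hone : IsKernel (fun _ _ : α => (1 : ℝ)) := ⟨measurable_const, fun _ _ => by simp⟩
    rw [integral_prod_symm _ (integrable_mul_of_memLp_two (memLp_fiberIntegral hone (Lp.memLp F)) (Lp.memLp F))]
    refine integral_nonneg fun y => ?_
    simp only [fiberIntegral, one_mul, integral_const_mul]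
    exact mul_self_nonneg _
  linarith

/-! ### Integration in the second variable, and commutation -/

section commute

variable {l : β → β → ℝ}

/-- Exchange of the coordinates as an isometry of the `L²` spaces. -/
def swapOp (hm : m = μ.prod ν) {m' : Measure (β × α)} (hm' : m' = ν.prod μ) :
    Lp ℝ 2 m →ₗᵢ[ℝ] Lp ℝ 2 m' :=
  Lp.compMeasurePreservingₗᵢ ℝ Prod.swap
    (by subst hm hm'; exact Measure.measurePreserving_swap)

lemma coeFn_swapOp (hm : m = μ.prod ν) {m' : Measure (β × α)} (hm' : m' = ν.prod μ)
    (F : Lp ℝ 2 m) : swapOp hm hm' F =ᵐ[m'] fun p => F p.swap :=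
  Lp.coeFn_compMeasurePreserving F _

lemma swapOp_swapOp (hm : m = μ.prod ν) {m' : Measure (β × α)} (hm' : m' = ν.prod μ)
    (F : Lp ℝ 2 m) : swapOp hm' hm (swapOp hm hm' F) = F := by
  refine Lp.ext ?_
  filter_upwards [coeFn_swapOp hm' hm (swapOp hm hm' F),
    (by subst hm hm'; exact Measure.measurePreserving_swap :
      MeasurePreserving Prod.swap m m').quasiMeasurePreserving.ae (coeFn_swapOp hm hm' F)]
    with p h1 h2
  rw [h1, h2, Prod.swap_swap]

lemma inner_swapOp_left (hm : m = μ.prod ν) {m' : Measure (β × α)} (hm' : m' = ν.prod μ)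
    (F : Lp ℝ 2 m) (G : Lp ℝ 2 m') :
    inner ℝ (swapOp hm hm' F) G = inner ℝ F (swapOp hm' hm G) := by
  conv_lhs => rw [← swapOp_swapOp hm' hm G]
  exact (swapOp hm hm').inner_map_map _ _

/-- Partial integration in the second variable. -/
def fiberOp₂ (hm : m = μ.prod ν) (hl : IsKernel l) : Lp ℝ 2 m →L[ℝ] Lp ℝ 2 m :=
  (swapOp (m := ν.prod μ) rfl hm).toContinuousLinearMap ∘L
    fiberOp rfl hl ∘L (swapOp hm (m' := ν.prod μ) rfl).toContinuousLinearMap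

/-- The measure `m'` is left free so that it can also be Lebesgue measure on the rectangle with
exchanged sides, as in `primY_apply`. -/
lemma fiberOp₂_apply (hm : m = μ.prod ν) {m' : Measure (β × α)} (hm' : m' = ν.prod μ)
    (hl : IsKernel l) (F : Lp ℝ 2 m) :
    fiberOp₂ hm hl F = swapOp hm' hm (fiberOp hm' hl (swapOp hm hm' F)) := by
  subst hm'
  rfl

lemma adjoint_fiberOp₂ (hm : m = μ.prod ν) (hl : IsKernel l) :
    ContinuousLinearMap.adjoint (fiberOp₂ hm hl) = fiberOp₂ hm hl.swap := by
  refine ((ContinuousLinearMap.eq_adjoint_iff _ _).2 fun F G => ?_).symm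
  rw [fiberOp₂_apply hm rfl, fiberOp₂_apply hm rfl, inner_swapOp_left, ← adjoint_fiberOp,
    ContinuousLinearMap.adjoint_inner_left, inner_swapOp_left]

lemma inner_fiberOp₂_self_nonneg (hm : m = μ.prod ν) (hl : IsKernel l)
    (h1 : ∀ x, ∀ᵐ s ∂ν, l x s + l s x = 1) (F : Lp ℝ 2 m) :
    0 ≤ inner ℝ (fiberOp₂ hm hl F) F := by
  rw [fiberOp₂_apply hm rfl, inner_swapOp_left]
  exact inner_fiberOp_self_nonneg rfl hl h1 _

lemma coeFn_fiberOp₂ (hm : m = μ.prod ν) (hl : IsKernel l) (F : Lp ℝ 2 m) :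
    fiberOp₂ hm hl F =ᵐ[m] fun p => ∫ t, l p.2 t * F (p.1, t) ∂ν := by
  rw [fiberOp₂_apply hm rfl]
  have hp : MeasurePreserving Prod.swap m (ν.prod μ) := by
    subst hm; exact Measure.measurePreserving_swap
  filter_upwards [coeFn_swapOp rfl hm (fiberOp rfl hl (swapOp hm rfl F)),
    hp.quasiMeasurePreserving.ae (coeFn_fiberOp rfl hl (swapOp hm rfl F)),
    hp.quasiMeasurePreserving.ae (fiberIntegral_congr l (coeFn_swapOp hm rfl F))] with p h1 h2 h3
  rw [h1, h2, h3]
  rfl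

/-- By Fubini both sides are the double integral of `k(x, s) l(y, t) F(s, t)`. Surjectivity of `𝒯`
rests on this commutation. -/
lemma fiberOp_fiberOp₂_comm (hm : m = μ.prod ν) (hk : IsKernel k) (hl : IsKernel l)
    (F : Lp ℝ 2 m) : fiberOp hm hk (fiberOp₂ hm hl F) = fiberOp₂ hm hl (fiberOp hm hk F) := by
  subst hm
  refine Lp.ext ?_
  have hswap : ∀ᵐ x ∂μ, ∀ᵐ t ∂ν, fiberOp rfl hk F (x, t) = fiberIntegral μ k F (x, t) :=
    Measure.ae_ae_of_ae_prod (coeFn_fiberOp rfl hk F)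
  have hi : Integrable F (μ.prod ν) := (Lp.memLp F).integrable (by norm_num)
  filter_upwards [coeFn_fiberOp rfl hk (fiberOp₂ rfl hl F),
    fiberIntegral_congr k (coeFn_fiberOp₂ rfl hl F), coeFn_fiberOp₂ rfl hl (fiberOp rfl hk F),
    Measure.quasiMeasurePreserving_fst.ae hswap] with p h1 h2 h3 h4
  rw [h1, h2, h3]
  have e : ∫ t, l p.2 t * fiberOp rfl hk F (p.1, t) ∂ν =
      ∫ t, l p.2 t * ∫ s, k p.1 s * F (s, t) ∂μ ∂ν := by
    refine integral_congr_ae ?_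
    filter_upwards [h4] with t ht
    rw [ht]
    rfl
  rw [e]
  simp only [fiberIntegral, ← integral_const_mul]
  rw [integral_integral_swap]
  · refine integral_congr_ae (ae_of_all _ fun t => integral_congr_ae (ae_of_all _ fun s => ?_))
    simp only
    ring
  · have hkm : Measurable fun q : α × β => k p.1 q.1 :=
      hk.measurable.comp (measurable_const.prodMk measurable_fst)
    have hlm : Measurable fun q : α × β => l p.2 q.2 :=
      hl.measurable.comp (measurable_const.prodMk measurable_snd)
    exact (hi.bdd_mul (c := 1) hlm.aestronglyMeasurable
      (ae_of_all _ fun q => hl.abs_le _ _)).bdd_mul (c := 1) hkm.aestronglyMeasurable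
      (ae_of_all _ fun q => hk.abs_le _ _)

end commute

end fiber


/-! ### Primitives and test functions on an interval -/

section onedim

/-- The kernel of the primitive vanishing at the left end point. -/
def below (x s : ℝ) : ℝ := if s < x then 1 else 0

lemma isKernel_below : IsKernel below := by
  refine ⟨?_, fun x s => ?_⟩
  · exact Measurable.ite (measurableSet_lt measurable_snd measurable_fst)
      measurable_const measurable_const
  · unfold below
    split_ifs <;> simp

lemma below_add_below (ℓ x : ℝ) :
    ∀ᵐ s ∂(volume.restrict (Ioo 0 ℓ)), below x s + below s x = 1 := by
  have h : ∀ᵐ s ∂(volume.restrict (Ioo 0 ℓ)), s ≠ x :=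
    ae_restrict_of_ae (Measure.ae_ne volume x)
  filter_upwards [h] with s hs
  rcases lt_or_gt_of_ne hs with h | h
  · simp [below, h, h.not_gt]
  · simp [below, h, h.not_gt]

lemma integral_below_mul {ℓ x : ℝ} (hx : x ∈ Ioo 0 ℓ) (g : ℝ → ℝ) :
    ∫ s in Ioo 0 ℓ, below x s * g s = ∫ s in 0..x, g s := by
  have e : (fun s => below x s * g s) = (Iio x).indicator g := by
    ext s
    by_cases h : s < x <;> simp [below, h]
  rw [e, setIntegral_indicator measurableSet_Iio, intervalIntegral.integral_of_le hx.1.le,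
    integral_Ioc_eq_integral_Ioo, Ioo_inter_Iio, min_eq_right hx.2.le]

lemma integral_above_mul {ℓ x : ℝ} (hx : x ∈ Ioo 0 ℓ) (g : ℝ → ℝ) :
    ∫ s in Ioo 0 ℓ, below s x * g s = ∫ s in x..ℓ, g s := by
  have e : (fun s => below s x * g s) = (Ioi x).indicator g := by
    ext s
    by_cases h : x < s <;> simp [below, h]
  rw [e, setIntegral_indicator measurableSet_Ioi, intervalIntegral.integral_of_le hx.2.le,
    integral_Ioc_eq_integral_Ioo, inter_comm, Ioi_inter_Ioo, max_eq_left hx.1.le]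

lemma IsTestFunction.eq_zero {E : Type*} [NormedAddCommGroup E] [NormedSpace ℝ E] {U : Set E}
    {φ : E → ℝ} (h : IsTestFunction U φ) {p : E} (hp : p ∉ U) : φ p = 0 :=
  image_eq_zero_of_notMem_tsupport fun hh => hp (h.2.2 hh)

lemma IsTestFunction.exists_bound {E : Type*} [NormedAddCommGroup E] [NormedSpace ℝ E] {U : Set E}
    {φ : E → ℝ} (h : IsTestFunction U φ) : ∃ C, 0 ≤ C ∧ ∀ p, |φ p| ≤ C := by
  obtain ⟨C, hC⟩ := h.2.1.exists_bound_of_continuous h.1.continuous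
  exact ⟨C, (norm_nonneg _).trans (hC 0), hC⟩

/-- The primitive of a test function with vanishing mean is a test function. -/
lemma IsTestFunction.primitive {ℓ : ℝ} {ψ : ℝ → ℝ} (h : IsTestFunction (Ioo 0 ℓ) ψ)
    (h0 : ∫ s in 0..ℓ, ψ s = 0) :
    IsTestFunction (Ioo 0 ℓ) (fun x => ∫ s in 0..x, ψ s) ∧
      deriv (fun x => ∫ s in 0..x, ψ s) = ψ := by
  have hc := h.1.continuous
  have hd : ∀ x, HasDerivAt (fun x => ∫ s in 0..x, ψ s) (ψ x) x := fun x =>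
    intervalIntegral.integral_hasDerivAt_right (hc.intervalIntegrable _ _)
      (hc.stronglyMeasurableAtFilter _ _) hc.continuousAt
  have hderiv : deriv (fun x => ∫ s in 0..x, ψ s) = ψ := funext fun x => (hd x).deriv
  refine ⟨?_, hderiv⟩
  have hsmooth : ContDiff ℝ ∞ (fun x => ∫ s in 0..x, ψ s) := by
    rw [contDiff_infty_iff_deriv, hderiv]
    exact ⟨fun x => (hd x).differentiableAt, h.1⟩
  obtain ⟨a, b, ha, hb, hab⟩ : ∃ a b, 0 < a ∧ b < ℓ ∧ tsupport ψ ⊆ Icc a b := by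
    rcases (tsupport ψ).eq_empty_or_nonempty with he | hne
    -- For `ψ = 0` any bounds inside `(0, ℓ)` serve; `Icc a b` may be empty here.
    · exact ⟨1, ℓ - 1, one_pos, by linarith, by simp [he]⟩
    · obtain ⟨a, ha, ha'⟩ := h.2.1.isCompact.exists_isLeast hne
      obtain ⟨b, hb, hb'⟩ := h.2.1.isCompact.exists_isGreatest hne
      exact ⟨a, b, (h.2.2 ha).1, (h.2.2 hb).2, fun x hx => ⟨ha' hx, hb' hx⟩⟩
  have hz : ∀ x, x ∉ Icc a b → ψ x = 0 := fun x hx =>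
    image_eq_zero_of_notMem_tsupport fun hh => hx (hab hh)
  have hvan : ∀ x, x ∉ Icc a b → ∫ s in 0..x, ψ s = 0 := by
    intro x hx
    by_cases hxa : x < a
    · refine intervalIntegral.integral_zero_ae (ae_of_all _ fun s hs => hz s fun hs' => ?_)
      have := hs.2
      have h2 : max 0 x < a := max_lt ha hxa
      exact absurd (hs.2.trans_lt h2) (not_lt.2 hs'.1)
    · have hxb : b < x := by
        by_contra hh
        exact hx ⟨not_lt.1 hxa, not_lt.1 hh⟩
      -- To the right of the support the vanishing mean allows integration to start at `ℓ` instead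
      -- of `0`, and the path from `ℓ` to `x` misses the support.
      rw [← intervalIntegral.integral_add_adjacent_intervals (b := ℓ) (hc.intervalIntegrable _ _)
        (hc.intervalIntegrable _ _), h0, zero_add]
      refine intervalIntegral.integral_zero_ae (ae_of_all _ fun s hs => hz s fun hs' => ?_)
      have h2 : b < min ℓ x := lt_min hb hxb
      exact absurd (h2.trans hs.1) (not_lt.2 hs'.2)
  have hts : tsupport (fun x => ∫ s in 0..x, ψ s) ⊆ Icc a b := by
    refine closure_minimal (fun x hx => ?_) isClosed_Icc
    by_contra hh
    exact hx (hvan x hh)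
  exact ⟨hsmooth, isCompact_Icc.of_isClosed_subset (isClosed_tsupport _) hts,
    hts.trans fun x hx => ⟨ha.trans_le hx.1, hx.2.trans_lt hb⟩⟩

lemma exists_isTestFunction_integral_eq_one {ℓ : ℝ} (hℓ : 0 < ℓ) :
    ∃ η : ℝ → ℝ, IsTestFunction (Ioo 0 ℓ) η ∧ ∫ s in 0..ℓ, η s = 1 := by
  let b : ContDiffBump (ℓ / 2) := ⟨ℓ / 8, ℓ / 4, by positivity, by linarith⟩
  have hts : tsupport (b.normed volume) ⊆ Ioo 0 ℓ := by
    rw [b.tsupport_normed_eq, Real.closedBall_eq_Icc]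
    change Icc (ℓ / 2 - ℓ / 4) (ℓ / 2 + ℓ / 4) ⊆ _
    exact fun x hx => ⟨by linarith [hx.1], by linarith [hx.2]⟩
  refine ⟨b.normed volume, ⟨b.contDiff_normed, b.hasCompactSupport_normed, hts⟩, ?_⟩
  rw [← b.integral_normed (μ := volume), intervalIntegral.integral_of_le hℓ.le,
    setIntegral_eq_integral_of_forall_compl_eq_zero]
  intro x hx
  exact image_eq_zero_of_notMem_tsupport fun hh => hx (Ioo_subset_Ioc_self (hts hh))

lemma integral_smul_test {ℓ : ℝ} {g ψ : ℝ → ℝ} (hψ : IsTestFunction (Ioo 0 ℓ) ψ) :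
    ∫ x, ψ x • g x = ∫ x in Ioo 0 ℓ, g x * ψ x := by
  rw [← setIntegral_eq_integral_of_forall_compl_eq_zero (s := Ioo 0 ℓ)]
  · exact integral_congr_ae (ae_of_all _ fun p => by simp [mul_comm])
  · intro x hx
    simp [hψ.eq_zero hx]

lemma ae_eq_zero_of_forall_isTestFunction {ℓ : ℝ} {g : ℝ → ℝ}
    (hg : IntegrableOn g (Ioo 0 ℓ))
    (h : ∀ ψ, IsTestFunction (Ioo 0 ℓ) ψ → ∫ x in Ioo 0 ℓ, g x * ψ x = 0) :
    ∀ᵐ x ∂(volume.restrict (Ioo 0 ℓ)), g x = 0 := by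
  refine (ae_restrict_iff' measurableSet_Ioo).2 ?_
  refine isOpen_Ioo.ae_eq_zero_of_integral_contDiff_smul_eq_zero hg.locallyIntegrableOn ?_
  intro ψ h1 h2 h3
  rw [integral_smul_test ⟨h1, h2, h3⟩]
  exact h ψ ⟨h1, h2, h3⟩

/-- The lemma of du Bois-Reymond. -/
lemma exists_ae_eq_const {ℓ : ℝ} (hℓ : 0 < ℓ) {g : ℝ → ℝ} (hg : IntegrableOn g (Ioo 0 ℓ))
    (h : ∀ η, IsTestFunction (Ioo 0 ℓ) η → ∫ x in Ioo 0 ℓ, g x * deriv η x = 0) :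
    ∃ c, ∀ᵐ x ∂(volume.restrict (Ioo 0 ℓ)), g x = c := by
  obtain ⟨η, hη, hη1⟩ := exists_isTestFunction_integral_eq_one hℓ
  -- The only possible value of the constant, since `η` has integral one.
  set c := ∫ x in Ioo 0 ℓ, g x * η x with hc
  have hint : ∀ ψ, IsTestFunction (Ioo 0 ℓ) ψ → IntegrableOn (fun x => g x * ψ x) (Ioo 0 ℓ) := by
    intro ψ hψ
    obtain ⟨C, -, hC⟩ := hψ.exists_bound
    exact hg.mul_bdd (c := C) hψ.1.continuous.aestronglyMeasurable (ae_of_all _ hC)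
  have hI : ∀ ψ : ℝ → ℝ, ∫ s in 0..ℓ, ψ s = ∫ s in Ioo 0 ℓ, ψ s := fun ψ => by
    rw [intervalIntegral.integral_of_le hℓ.le, integral_Ioc_eq_integral_Ioo]
  have hz : ∀ᵐ x ∂(volume.restrict (Ioo 0 ℓ)), g x - c = 0 := by
    refine ae_eq_zero_of_forall_isTestFunction (hg.sub (integrable_const c)) fun ψ hψ => ?_
    set d := ∫ s in 0..ℓ, ψ s with hd
    have hcψ := hψ.1.continuous
    have hcη := hη.1.continuous
    -- Subtracting `d η` removes the mean of `ψ`, so the difference is the derivative of a test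
    -- function and `h` applies to it.
    have htest : IsTestFunction (Ioo 0 ℓ) (fun x => ψ x - d * η x) := by
      refine ⟨hψ.1.sub (contDiff_const.mul hη.1), hψ.2.1.sub hη.2.1.mul_left, ?_⟩
      refine (tsupport_sub _ _).trans (union_subset hψ.2.2 ?_)
      exact (tsupport_mul_subset_right).trans hη.2.2
    have hmean : ∫ s in 0..ℓ, (ψ s - d * η s) = 0 := by
      rw [intervalIntegral.integral_sub (hcψ.intervalIntegrable _ _)
        ((hcη.intervalIntegrable _ _).const_mul d), intervalIntegral.integral_const_mul,
        hη1, ← hd]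
      ring
    obtain ⟨h1, h2⟩ := htest.primitive hmean
    have h3 := h _ h1
    rw [h2] at h3
    have e1 : ∫ x in Ioo 0 ℓ, g x * (ψ x - d * η x) = (∫ x in Ioo 0 ℓ, g x * ψ x) - d * c := by
      rw [hc, ← integral_const_mul, ← integral_sub (hint ψ hψ) ((hint η hη).const_mul d)]
      exact integral_congr_ae (ae_of_all _ fun x => by ring)
    have e2 : ∫ x in Ioo 0 ℓ, (g x - c) * ψ x = (∫ x in Ioo 0 ℓ, g x * ψ x) - c * d := by
      rw [hd, hI, ← integral_const_mul, ← integral_sub (hint ψ hψ)]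
      · exact integral_congr_ae (ae_of_all _ fun x => by ring)
      · exact ((hcψ.integrable_of_hasCompactSupport hψ.2.1).integrableOn).const_mul c
    rw [e2, mul_comm c d, ← e1, h3]
  exact ⟨c, hz.mono fun x hx => sub_eq_zero.1 hx⟩

end onedim

/-! ### Functions on a product determined by partial pairings -/

section uniqueness

variable {α β : Type*} [MeasurableSpace α] [MeasurableSpace β]
  {μ : Measure α} {ν : Measure β} [IsFiniteMeasure μ] [IsFiniteMeasure ν]

/-- An integrable function is determined by its integrals over measurable rectangles. -/
lemma ae_eq_zero_of_forall_setIntegral_prod {w : α × β → ℝ} (hw : Integrable w (μ.prod ν))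
    (h : ∀ s t, MeasurableSet s → MeasurableSet t → ∫ p in s ×ˢ t, w p ∂(μ.prod ν) = 0) :
    w =ᵐ[μ.prod ν] 0 := by
  suffices key : ∀ S, MeasurableSet S → ∫ p in S, w p ∂(μ.prod ν) = 0 from
    hw.ae_eq_zero_of_forall_setIntegral_eq_zero fun S hS _ => key S hS
  intro S hS
  induction S, hS using MeasurableSpace.induction_on_inter generateFrom_prod.symm isPiSystem_prod with
  | empty => simp
  | basic S hS =>
    obtain ⟨s, hs, t, ht, rfl⟩ := hS
    exact h s t hs ht
  | compl S hS ih =>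
    have h1 := integral_add_compl hS hw
    have h2 := h univ univ MeasurableSet.univ MeasurableSet.univ
    rw [univ_prod_univ, Measure.restrict_univ] at h2
    rw [ih, h2, zero_add] at h1
    exact h1
  | iUnion f hd hm ih =>
    rw [integral_iUnion hm hd hw.integrableOn]
    simp [ih]

/-- The exceptional set of `x` depends on `φ`, so `x` cannot simply be frozen. Integrating over `x ∈
s` first removes this dependence: `y ↦ ∫_s w(x, y) dx` is orthogonal to all test functions, hence
zero almost everywhere, and so all integrals over rectangles vanish. -/
lemma ae_eq_zero_of_forall_partial_pairing {ℓ : ℝ} {w : α × ℝ → ℝ}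
    (hw : Integrable w (μ.prod (volume.restrict (Ioo 0 ℓ))))
    (h : ∀ φ, IsTestFunction (Ioo 0 ℓ) φ → ∀ᵐ x ∂μ, ∫ y in Ioo 0 ℓ, w (x, y) * φ y = 0) :
    w =ᵐ[μ.prod (volume.restrict (Ioo 0 ℓ))] 0 := by
  refine ae_eq_zero_of_forall_setIntegral_prod hw fun s t hs ht => ?_
  have hws : Integrable w ((μ.restrict s).prod (volume.restrict (Ioo 0 ℓ))) := by
    have := hw.integrableOn (s := s ×ˢ univ)
    rwa [IntegrableOn, ← Measure.prod_restrict, Measure.restrict_univ] at this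
  have hy : ∀ᵐ y ∂(volume.restrict (Ioo 0 ℓ)), ∫ x in s, w (x, y) ∂μ = 0 := by
    refine ae_eq_zero_of_forall_isTestFunction hws.integral_prod_right fun φ hφ => ?_
    obtain ⟨C, -, hC⟩ := hφ.exists_bound
    simp only [← integral_mul_const]
    rw [integral_integral_swap]
    · refine integral_eq_zero_of_ae ?_
      exact ae_restrict_of_ae (h φ hφ)
    · refine Integrable.mul_bdd (c := C) hws.swap ?_ (ae_of_all _ fun p => hC p.1)
      exact (hφ.1.continuous.measurable.comp measurable_fst).aestronglyMeasurable
  rw [← Measure.prod_restrict, integral_prod_symm]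
  · exact integral_eq_zero_of_ae (ae_restrict_of_ae hy)
  · have := hw.integrableOn (s := s ×ˢ t)
    rwa [IntegrableOn, ← Measure.prod_restrict] at this

end uniqueness


/-! ### Weak derivatives and traces of scalar functions on the rectangle -/

variable {L₁ L₂ : ℝ}

/-- The real Hilbert space `L²(Ω)` of scalar functions. -/
abbrev L2Scal (L₁ L₂ : ℝ) : Type :=
  Lp ℝ 2 ((volume : Measure (ℝ × ℝ)).restrict (rect L₁ L₂))

/-- `X` is the weak derivative `u_x`. -/
def HasWeakDx (u X : L2Scal L₁ L₂) : Prop :=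
  ∀ φ : ℝ × ℝ → ℝ, IsTestFunction (rect L₁ L₂) φ →
    ∫ p in rect L₁ L₂, X p * φ p = -∫ p in rect L₁ L₂, u p * dx φ p

/-- `Y` is the weak derivative `u_y`. -/
def HasWeakDy (u Y : L2Scal L₁ L₂) : Prop :=
  ∀ φ : ℝ × ℝ → ℝ, IsTestFunction (rect L₁ L₂) φ →
    ∫ p in rect L₁ L₂, Y p * φ p = -∫ p in rect L₁ L₂, u p * dy φ p

/-- Vanishing of the trace of a scalar function, in the sense of `ZeroTraceAlong`. -/
def HasZeroTrace (strip : ℝ → Set (ℝ × ℝ)) (τ : ℝ × ℝ → ℝ) (ℓ : ℝ) (u : L2Scal L₁ L₂) : Prop :=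
  ∀ φ : ℝ → ℝ, IsTestFunction (Ioo 0 ℓ) φ →
    Tendsto (fun ε : ℝ => ε⁻¹ * ∫ p in rect L₁ L₂ ∩ strip ε, u p * φ (τ p)) (𝓝[>] 0) (𝓝 0)

lemma restrict_rect (L₁ L₂ : ℝ) : (volume : Measure (ℝ × ℝ)).restrict (rect L₁ L₂) =
    (volume.restrict (Ioo 0 L₁)).prod (volume.restrict (Ioo 0 L₂)) := by
  rw [Measure.prod_restrict]
  rfl

lemma measurableSet_rect (L₁ L₂ : ℝ) : MeasurableSet (rect L₁ L₂) :=
  measurableSet_Ioo.prod measurableSet_Ioo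

lemma memLp_rect_of_bound {g : ℝ × ℝ → ℝ} (hg : Measurable g) {C : ℝ} (hC : ∀ p, |g p| ≤ C) :
    MemLp g 2 ((volume : Measure (ℝ × ℝ)).restrict (rect L₁ L₂)) :=
  MemLp.of_bound hg.aestronglyMeasurable C (ae_of_all _ hC)

lemma IsTestFunction.memLp {U : Set (ℝ × ℝ)} {φ : ℝ × ℝ → ℝ} (h : IsTestFunction U φ) :
    MemLp φ 2 ((volume : Measure (ℝ × ℝ)).restrict (rect L₁ L₂)) := by
  obtain ⟨C, -, hC⟩ := h.exists_bound
  exact memLp_rect_of_bound h.1.continuous.measurable hC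

lemma IsTestFunction.memLp_dx {U : Set (ℝ × ℝ)} {φ : ℝ × ℝ → ℝ} (h : IsTestFunction U φ) :
    MemLp (dx φ) 2 ((volume : Measure (ℝ × ℝ)).restrict (rect L₁ L₂)) := by
  obtain ⟨C, hC⟩ := (h.2.1.fderiv_apply (𝕜 := ℝ) (1, 0)).exists_bound_of_continuous h.continuous_dx
  exact memLp_rect_of_bound h.continuous_dx.measurable hC

/-- The primitive `∫₀ˣ` in the first variable. -/
def primX (L₁ L₂ : ℝ) : L2Scal L₁ L₂ →L[ℝ] L2Scal L₁ L₂ :=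
  fiberOp (restrict_rect L₁ L₂) isKernel_below

/-- The primitive `∫₀ʸ` in the second variable. -/
def primY (L₁ L₂ : ℝ) : L2Scal L₁ L₂ →L[ℝ] L2Scal L₁ L₂ :=
  fiberOp₂ (restrict_rect L₁ L₂) isKernel_below

lemma integral_fiberOp_mul {k : ℝ → ℝ → ℝ} (hk : IsKernel k) (X : L2Scal L₁ L₂)
    {g : ℝ × ℝ → ℝ} (hg : MemLp g 2 ((volume : Measure (ℝ × ℝ)).restrict (rect L₁ L₂))) :
    ∫ p in rect L₁ L₂, fiberOp (restrict_rect L₁ L₂) hk X p * g p =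
      ∫ p in rect L₁ L₂, X p *
        fiberIntegral (volume.restrict (Ioo 0 L₁)) (fun x s => k s x) g p := by
  have h := integral_fiberIntegral_mul (μ := volume.restrict (Ioo 0 L₁))
    (ν := volume.restrict (Ioo 0 L₂)) hk (f := X) (g := g)
    (by rw [← restrict_rect]; exact Lp.memLp X) (by rwa [← restrict_rect])
  rw [← restrict_rect] at h
  rw [← h]
  refine integral_congr_ae ?_
  filter_upwards [coeFn_fiberOp (restrict_rect L₁ L₂) hk X] with p hp
  rw [hp]

lemma IsTestFunction.integral_dx {U : Set (ℝ × ℝ)} {φ : ℝ × ℝ → ℝ} (h : IsTestFunction U φ)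
    (a b y : ℝ) : ∫ s in a..b, dx φ (s, y) = φ (b, y) - φ (a, y) := by
  refine intervalIntegral.integral_eq_sub_of_hasDerivAt (f := fun s => φ (s, y)) (fun s _ => ?_)
    ((h.continuous_dx.comp (by fun_prop : Continuous fun s : ℝ => (s, y))).intervalIntegrable _ _)
  have hd : HasFDerivAt φ (fderiv ℝ φ (s, y)) (s, y) :=
    (h.1.differentiable (by simp)).differentiableAt.hasFDerivAt
  exact hd.comp_hasDerivAt s ((hasDerivAt_id s).prodMk (hasDerivAt_const s y))

/-- The adjoint moves the integration onto the test function: `∫` of `φ_x` from `x` to `L₁` is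
`-φ(x, y)`, because `φ` vanishes at `x = L₁`. -/
lemma hasWeakDx_primX (X : L2Scal L₁ L₂) : HasWeakDx (primX L₁ L₂ X) X := by
  intro φ hφ
  rw [primX, integral_fiberOp_mul isKernel_below X hφ.memLp_dx, ← integral_neg]
  refine setIntegral_congr_fun (measurableSet_rect L₁ L₂) fun p hp => ?_
  have h0 : φ (L₁, p.2) = 0 := hφ.eq_zero fun hh => lt_irrefl _ hh.1.2
  simp only [fiberIntegral]
  rw [integral_above_mul hp.1 (fun s => dx φ (s, p.2)), hφ.integral_dx, h0]
  simp

lemma hasWeakDx_adjoint_primX (X : L2Scal L₁ L₂) :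
    HasWeakDx (ContinuousLinearMap.adjoint (primX L₁ L₂) X) (-X) := by
  intro φ hφ
  rw [primX, adjoint_fiberOp, integral_fiberOp_mul isKernel_below.swap X hφ.memLp_dx,
    ← integral_neg]
  refine integral_congr_ae ?_
  filter_upwards [Lp.coeFn_neg X, ae_restrict_mem (measurableSet_rect L₁ L₂)] with p hn hp
  have h0 : φ (0, p.2) = 0 := hφ.eq_zero fun hh => lt_irrefl _ hh.1.1
  simp only [fiberIntegral]
  rw [integral_below_mul hp.1 (fun s => dx φ (s, p.2)), hφ.integral_dx, h0, hn]
  simp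

lemma integral_strip_mul {A : Set ℝ} (hA : MeasurableSet A) (u : ℝ × ℝ → ℝ) (φ : ℝ → ℝ) :
    ∫ p in rect L₁ L₂ ∩ {p | p.1 ∈ A}, u p * φ p.2 =
      ∫ p in rect L₁ L₂, u p * (A.indicator 1 p.1 * φ p.2) := by
  have hS : MeasurableSet {p : ℝ × ℝ | p.1 ∈ A} := hA.preimage measurable_fst
  rw [← setIntegral_indicator hS]
  refine integral_congr_ae (ae_of_all _ fun p => ?_)
  by_cases h : p.1 ∈ A
  · simp [indicator, h]
  · simp [indicator, h]

/-- Transposing the operator onto the indicator of the strip writes the strip average as `∫ X H_ε`.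
The functions `H_ε` are bounded by `sup |φ|`, as the strip has width at most `ε`, and they vanish at
each fixed point for small `ε` by `hk0`; dominated convergence concludes. Both the west and the east
side are instances. -/
lemma hasZeroTrace_fiberOp {k : ℝ → ℝ → ℝ} (hk : IsKernel k) {A : ℝ → Set ℝ}
    (hA : ∀ ε, MeasurableSet (A ε))
    (hle : ∀ ε > 0, (volume.restrict (Ioo 0 L₁)).real (A ε) ≤ ε)
    (hk0 : ∀ x ∈ Ioo 0 L₁, ∀ᶠ ε in 𝓝[>] 0, ∀ s ∈ A ε, k s x = 0) (X : L2Scal L₁ L₂) :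
    HasZeroTrace (fun ε => {p | p.1 ∈ A ε}) Prod.snd L₂
      (fiberOp (restrict_rect L₁ L₂) hk X) := by
  intro φ hφ
  obtain ⟨C, hC0, hC⟩ := hφ.exists_bound
  set μ : Measure ℝ := volume.restrict (Ioo 0 L₁) with hμ
  let H : ℝ → ℝ × ℝ → ℝ := fun ε p =>
    ε⁻¹ * fiberIntegral μ (fun x s => k s x) (fun p => (A ε).indicator 1 p.1 * φ p.2) p
  have hmeas : ∀ ε, Measurable fun p : ℝ × ℝ => (A ε).indicator (1 : ℝ → ℝ) p.1 * φ p.2 :=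
    fun ε => ((measurable_one.indicator (hA ε)).comp measurable_fst).mul
      (hφ.1.continuous.measurable.comp measurable_snd)
  have hind : ∀ ε x, |(A ε).indicator (1 : ℝ → ℝ) x| ≤ 1 := fun ε x => by
    by_cases h : x ∈ A ε <;> simp [h]
  have hmem : ∀ ε, MemLp (fun p : ℝ × ℝ => (A ε).indicator (1 : ℝ → ℝ) p.1 * φ p.2) 2
      ((volume : Measure (ℝ × ℝ)).restrict (rect L₁ L₂)) := fun ε => by
    refine memLp_rect_of_bound (hmeas ε) (C := C) fun p => ?_
    rw [abs_mul]
    exact (mul_le_of_le_one_left (abs_nonneg _) (hind _ _)).trans (hC _)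
  have heq : ∀ ε, ε⁻¹ * ∫ p in rect L₁ L₂ ∩ {p | p.1 ∈ A ε},
      fiberOp (restrict_rect L₁ L₂) hk X p * φ p.2 = ∫ p in rect L₁ L₂, X p * H ε p := by
    intro ε
    rw [integral_strip_mul (hA ε), integral_fiberOp_mul hk X (hmem ε), ← integral_const_mul]
    exact integral_congr_ae (ae_of_all _ fun p => by simp only [H]; ring)
  have hb : ∀ ε > 0, ∀ p, |H ε p| ≤ C := by
    intro ε hε p
    have h1 : ‖∫ s, k s p.1 * ((A ε).indicator 1 s * φ p.2) ∂μ‖ ≤ ∫ s, (A ε).indicator (fun _ => C) s ∂μ := by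
      refine norm_integral_le_of_norm_le
        ((integrable_const (μ := μ) C).indicator (hA ε))
        (ae_of_all μ fun s => ?_)
      rw [norm_mul, Real.norm_eq_abs]
      refine (mul_le_of_le_one_left (norm_nonneg _) (hk.abs_le _ _)).trans ?_
      by_cases h : s ∈ A ε
      · simpa [h] using hC p.2
      · simp [h]
    rw [integral_indicator_const _ (hA ε), smul_eq_mul] at h1
    simp only [H]
    rw [abs_mul, abs_of_pos (inv_pos.2 hε), inv_mul_le_iff₀ hε]
    exact h1.trans (mul_le_mul_of_nonneg_right (hle ε hε) hC0)
  have hX : Integrable X ((volume : Measure (ℝ × ℝ)).restrict (rect L₁ L₂)) :=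
    (Lp.memLp X).integrable (by norm_num)
  simp only [heq]
  have hlim : Tendsto (fun ε => ∫ p in rect L₁ L₂, X p * H ε p) (𝓝[>] 0)
      (𝓝 (∫ p in rect L₁ L₂, (0 : ℝ))) := by
    refine tendsto_integral_filter_of_dominated_convergence (fun p => |X p| * C) ?_ ?_ ?_ ?_
    · refine Eventually.of_forall fun ε => hX.1.mul ?_
      refine AEStronglyMeasurable.const_mul ?_ _
      have := hmem ε
      rw [restrict_rect] at this ⊢
      exact aestronglyMeasurable_fiberIntegral hk.swap this.1
    · filter_upwards [self_mem_nhdsWithin] with ε hε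
      refine ae_of_all _ fun p => ?_
      rw [norm_mul]
      exact mul_le_mul_of_nonneg_left (hb ε hε p) (norm_nonneg _)
    · exact hX.abs.mul_const C
    · filter_upwards [ae_restrict_mem (measurableSet_rect L₁ L₂)] with p hp
      refine tendsto_const_nhds.congr' ?_
      filter_upwards [hk0 p.1 hp.1] with ε hε
      have : fiberIntegral μ (fun x s => k s x)
          (fun p => (A ε).indicator 1 p.1 * φ p.2) p = 0 := by
        refine integral_eq_zero_of_ae (ae_of_all _ fun s => ?_)
        by_cases h : s ∈ A ε
        · simp [hε s h]
        · simp [h]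
      simp [H, this]
  simpa using hlim

lemma isTestFunction_mul {η φ : ℝ → ℝ} (hη : IsTestFunction (Ioo 0 L₁) η)
    (hφ : IsTestFunction (Ioo 0 L₂) φ) :
    IsTestFunction (rect L₁ L₂) (fun p => η p.1 * φ p.2) := by
  have hts : tsupport (fun p : ℝ × ℝ => η p.1 * φ p.2) ⊆ tsupport η ×ˢ tsupport φ := by
    refine closure_minimal (fun p hp => ?_) ((isClosed_tsupport _).prod (isClosed_tsupport _))
    have := mul_ne_zero_iff.1 (Function.mem_support.1 hp)
    exact ⟨subset_closure this.1, subset_closure this.2⟩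
  exact ⟨(hη.1.comp contDiff_fst).mul (hφ.1.comp contDiff_snd),
    (hη.2.1.isCompact.prod hφ.2.1.isCompact).of_isClosed_subset (isClosed_tsupport _) hts,
    hts.trans (prod_mono hη.2.2 hφ.2.2)⟩

lemma dx_mul {η φ : ℝ → ℝ} (hη : IsTestFunction (Ioo 0 L₁) η) (hφ : IsTestFunction (Ioo 0 L₂) φ)
    (p : ℝ × ℝ) : dx (fun p => η p.1 * φ p.2) p = deriv η p.1 * φ p.2 := by
  have h := ((isTestFunction_mul hη hφ).1.differentiable (by simp) p).hasFDerivAt.comp_hasDerivAt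
    p.1 ((hasDerivAt_id p.1).prodMk (hasDerivAt_const p.1 p.2))
  have h2 := ((hη.1.differentiable (by simp) p.1).hasDerivAt).mul_const (φ p.2)
  exact h.unique h2

/-- Paired with a test function of `y`, the function `w` becomes a function of `x` with zero weak
derivative, hence a constant `c` by `exists_ae_eq_const`. Its averages over strips of width exactly
`ε` equal `c`, so the zero trace forces `c = 0`. -/
lemma eq_zero_of_hasWeakDx_zero (hL₁ : 0 < L₁) {A : ℝ → Set ℝ} (hA : ∀ ε, MeasurableSet (A ε))
    (heq : ∀ᶠ ε in 𝓝[>] 0, (volume.restrict (Ioo 0 L₁)).real (A ε) = ε) {w : L2Scal L₁ L₂}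
    (h : HasWeakDx w 0) (ht : HasZeroTrace (fun ε => {p | p.1 ∈ A ε}) Prod.snd L₂ w) : w = 0 := by
  set μ : Measure ℝ := volume.restrict (Ioo 0 L₁) with hμ
  set ν : Measure ℝ := volume.restrict (Ioo 0 L₂) with hν
  have hw : Integrable w (μ.prod ν) := by
    rw [← restrict_rect]
    exact (Lp.memLp w).integrable (by norm_num)
  suffices hz : w =ᵐ[μ.prod ν] 0 by
    rw [← restrict_rect] at hz
    exact (Lp.eq_zero_iff_ae_eq_zero).2 hz
  refine ae_eq_zero_of_forall_partial_pairing hw fun φ hφ => ?_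
  obtain ⟨C, -, hC⟩ := hφ.exists_bound
  have hwφ : Integrable (fun p : ℝ × ℝ => w p * φ p.2) (μ.prod ν) :=
    hw.mul_bdd (c := C) (hφ.1.continuous.comp continuous_snd).aestronglyMeasurable
      (ae_of_all _ fun p => hC p.2)
  have hbd : ∀ (f : ℝ → ℝ) (D : ℝ), Measurable f → (∀ x, |f x| ≤ D) →
      ∫ p in rect L₁ L₂, w p * (f p.1 * φ p.2) =
        ∫ x, (∫ y, w (x, y) * φ y ∂ν) * f x ∂μ := by
    intro f D hf hD
    have e : ∫ p in rect L₁ L₂, w p * (f p.1 * φ p.2) =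
        ∫ p, w p * (f p.1 * φ p.2) ∂(μ.prod ν) := by
      -- The type of `w` mentions the measure; only after forgetting it can the measure be
      -- rewritten.
      generalize (w : ℝ × ℝ → ℝ) = w'
      rw [restrict_rect]
    rw [e, integral_prod]
    · refine integral_congr_ae (ae_of_all _ fun x => ?_)
      simp only [← integral_mul_const]
      exact integral_congr_ae (ae_of_all _ fun y => by ring)
    · refine (hwφ.mul_bdd (c := D) (hf.comp measurable_fst).aestronglyMeasurable
        (ae_of_all _ fun p => hD p.1)).congr (ae_of_all _ fun p => ?_)
      simp only [Function.comp]
      ring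
  obtain ⟨c, hc⟩ : ∃ c, ∀ᵐ x ∂μ, ∫ y, w (x, y) * φ y ∂ν = c := by
    refine exists_ae_eq_const hL₁ hwφ.integral_prod_left fun η hη => ?_
    obtain ⟨D, hD⟩ := hη.2.1.deriv.exists_bound_of_continuous (hη.1.continuous_deriv (by simp))
    have h1 := h _ (isTestFunction_mul hη hφ)
    simp only [dx_mul hη hφ] at h1
    rw [hbd _ D (measurable_deriv η) hD] at h1
    rw [← neg_eq_zero, ← h1]
    refine integral_eq_zero_of_ae ?_
    filter_upwards [Lp.coeFn_zero ℝ 2 ((volume : Measure (ℝ × ℝ)).restrict (rect L₁ L₂))] with p hp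
    rw [hp]
    simp
  have hc0 : c = 0 := by
    refine tendsto_nhds_unique (tendsto_const_nhds.congr' ?_) (ht φ hφ)
    filter_upwards [heq, self_mem_nhdsWithin] with ε h1 h2
    rw [integral_strip_mul (hA ε), hbd _ 1 (measurable_one.indicator (hA ε)) fun x => by
      by_cases hx : x ∈ A ε <;> simp [hx]]
    have : ∫ x, (∫ y, w (x, y) * φ y ∂ν) * (A ε).indicator 1 x ∂μ =
        ∫ x, (A ε).indicator (fun _ => c) x ∂μ := by
      refine integral_congr_ae ?_
      filter_upwards [hc] with x hx
      by_cases h : x ∈ A ε <;> simp [h, hx]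
    rw [this, integral_indicator_const _ (hA ε), h1, smul_eq_mul,
      inv_mul_cancel_left₀ (ne_of_gt h2)]
  rw [hc0] at hc
  exact hc

lemma real_restrict_Ioo_Iio (L₁ ε : ℝ) :
    (volume.restrict (Ioo 0 L₁)).real (Iio ε) = max (min L₁ ε) 0 := by
  rw [measureReal_restrict_apply measurableSet_Iio, inter_comm, Ioo_inter_Iio, Real.volume_real_Ioo,
    sub_zero]

lemma real_restrict_Ioo_Ioi (L₁ ε : ℝ) :
    (volume.restrict (Ioo 0 L₁)).real (Ioi (L₁ - ε)) = max (min L₁ ε) 0 := by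
  rw [measureReal_restrict_apply measurableSet_Ioi, Ioi_inter_Ioo, Real.volume_real_Ioo]
  congr 1
  rcases le_total L₁ ε with h | h
  · rw [max_eq_right (by linarith), min_eq_left h, sub_zero]
  · rw [max_eq_left (by linarith), min_eq_right h]
    ring

lemma eventually_max_min_eq (hL₁ : 0 < L₁) : ∀ᶠ ε in 𝓝[>] (0 : ℝ), max (min L₁ ε) 0 = ε := by
  filter_upwards [Ioo_mem_nhdsGT hL₁] with ε hε
  rw [min_eq_right hε.2.le, max_eq_left hε.1.le]

lemma max_min_le {ε : ℝ} (hε : 0 < ε) : max (min L₁ ε) 0 ≤ ε :=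
  max_le (min_le_right _ _) hε.le

/-- Vanishing trace on the side `x = 0`. -/
def ZeroWest (u : L2Scal L₁ L₂) : Prop := HasZeroTrace (fun ε => {p | p.1 < ε}) Prod.snd L₂ u

/-- Vanishing trace on the side `x = L₁`. -/
def ZeroEast (u : L2Scal L₁ L₂) : Prop := HasZeroTrace (fun ε => {p | L₁ - ε < p.1}) Prod.snd L₂ u

/-- Vanishing trace on the side `y = 0`. -/
def ZeroSouth (u : L2Scal L₁ L₂) : Prop := HasZeroTrace (fun ε => {p | p.2 < ε}) Prod.fst L₁ u

/-- Vanishing trace on the side `y = L₂`. -/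
def ZeroNorth (u : L2Scal L₁ L₂) : Prop := HasZeroTrace (fun ε => {p | L₂ - ε < p.2}) Prod.fst L₁ u

lemma zeroWest_primX (X : L2Scal L₁ L₂) : ZeroWest (primX L₁ L₂ X) := by
  refine hasZeroTrace_fiberOp isKernel_below (A := fun ε => Iio ε) (fun _ => measurableSet_Iio)
    (fun ε hε => (real_restrict_Ioo_Iio L₁ ε).trans_le (max_min_le hε)) (fun x hx => ?_) X
  filter_upwards [Ioo_mem_nhdsGT hx.1] with ε hε s hs
  exact if_neg (not_lt.2 (hs.le.trans hε.2.le))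

lemma zeroEast_adjoint_primX (X : L2Scal L₁ L₂) :
    ZeroEast (ContinuousLinearMap.adjoint (primX L₁ L₂) X) := by
  rw [primX, adjoint_fiberOp]
  refine hasZeroTrace_fiberOp isKernel_below.swap (A := fun ε => Ioi (L₁ - ε))
    (fun _ => measurableSet_Ioi)
    (fun ε hε => (real_restrict_Ioo_Ioi L₁ ε).trans_le (max_min_le hε)) (fun x hx => ?_) X
  filter_upwards [Ioo_mem_nhdsGT (sub_pos.2 hx.2)] with ε hε s hs
  have : L₁ - ε < s := hs
  exact if_neg (not_lt.2 (by linarith [hε.2]))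

lemma HasWeakDx.sub {u v X Y : L2Scal L₁ L₂} (h : HasWeakDx u X) (h' : HasWeakDx v Y) :
    HasWeakDx (u - v) (X - Y) := by
  intro φ hφ
  have e : ∀ (f g : L2Scal L₁ L₂) (ψ : ℝ × ℝ → ℝ),
      MemLp ψ 2 ((volume : Measure (ℝ × ℝ)).restrict (rect L₁ L₂)) →
      ∫ p in rect L₁ L₂, (f - g) p * ψ p =
        (∫ p in rect L₁ L₂, f p * ψ p) - ∫ p in rect L₁ L₂, g p * ψ p := by
    intro f g ψ hψ
    rw [← integral_sub (integrable_mul_of_memLp_two (Lp.memLp f) hψ)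
      (integrable_mul_of_memLp_two (Lp.memLp g) hψ)]
    refine integral_congr_ae ?_
    filter_upwards [Lp.coeFn_sub f g] with p hp
    rw [hp, Pi.sub_apply, sub_mul]
  rw [e _ _ _ hφ.memLp, e _ _ _ hφ.memLp_dx, h φ hφ, h' φ hφ]
  ring

lemma HasZeroTrace.sub {strip : ℝ → Set (ℝ × ℝ)} {τ : ℝ × ℝ → ℝ} (hτ : Measurable τ) {ℓ : ℝ}
    {u v : L2Scal L₁ L₂} (h : HasZeroTrace strip τ ℓ u) (h' : HasZeroTrace strip τ ℓ v) :
    HasZeroTrace strip τ ℓ (u - v) := by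
  intro φ hφ
  obtain ⟨C, -, hC⟩ := hφ.exists_bound
  have hi : ∀ (f : L2Scal L₁ L₂) (ε : ℝ),
      IntegrableOn (fun p => f p * φ (τ p)) (rect L₁ L₂ ∩ strip ε) := fun f ε =>
    IntegrableOn.mono_set (integrable_mul_of_memLp_two (Lp.memLp f) (memLp_rect_of_bound
      (hφ.1.continuous.measurable.comp hτ) fun p => hC (τ p))) inter_subset_left
  have e := (h φ hφ).sub (h' φ hφ)
  rw [sub_zero] at e
  refine e.congr fun ε => ?_
  rw [← mul_sub, ← integral_sub (hi u ε) (hi v ε)]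
  congr 1
  refine integral_congr_ae ?_
  filter_upwards [ae_restrict_of_ae_restrict_of_subset inter_subset_left (Lp.coeFn_sub u v)]
    with p hp
  rw [hp, Pi.sub_apply, sub_mul]

/-- The difference of the two sides has zero weak derivative and zero trace at `x = 0`. -/
lemma eq_primX (hL₁ : 0 < L₁) {u X : L2Scal L₁ L₂} (h : HasWeakDx u X) (ht : ZeroWest u) :
    u = primX L₁ L₂ X := by
  refine sub_eq_zero.1 (eq_zero_of_hasWeakDx_zero hL₁ (A := fun ε => Iio ε)
    (fun _ => measurableSet_Iio) ?_ ?_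
    (HasZeroTrace.sub measurable_snd ht (zeroWest_primX X)))
  · filter_upwards [eventually_max_min_eq hL₁] with ε h1
    rw [real_restrict_Ioo_Iio L₁ ε, h1]
  · simpa using h.sub (hasWeakDx_primX X)

lemma eq_adjoint_primX (hL₁ : 0 < L₁) {u X : L2Scal L₁ L₂} (h : HasWeakDx u X)
    (ht : ZeroEast u) : u = ContinuousLinearMap.adjoint (primX L₁ L₂) (-X) := by
  refine sub_eq_zero.1 (eq_zero_of_hasWeakDx_zero hL₁ (A := fun ε => Ioi (L₁ - ε))
    (fun _ => measurableSet_Ioi) ?_ ?_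
    (HasZeroTrace.sub measurable_snd ht (zeroEast_adjoint_primX (-X))))
  · filter_upwards [eventually_max_min_eq hL₁] with ε h1
    rw [real_restrict_Ioo_Ioi L₁ ε, h1]
  · simpa using h.sub (hasWeakDx_adjoint_primX (-X))

/-! ### Transport to the variable `y` by exchange of coordinates -/

section swap

/-- Exchange of the coordinates. -/
def coordSwap (L₁ L₂ : ℝ) : L2Scal L₁ L₂ →ₗᵢ[ℝ] L2Scal L₂ L₁ :=
  swapOp (restrict_rect L₁ L₂) (restrict_rect L₂ L₁)

lemma coordSwap_coordSwap (u : L2Scal L₁ L₂) :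
    coordSwap L₂ L₁ (coordSwap L₁ L₂ u) = u := swapOp_swapOp _ _ u

lemma primY_apply (u : L2Scal L₁ L₂) :
    primY L₁ L₂ u = coordSwap L₂ L₁ (primX L₂ L₁ (coordSwap L₁ L₂ u)) :=
  fiberOp₂_apply _ _ _ u

lemma adjoint_primY_apply (u : L2Scal L₁ L₂) : ContinuousLinearMap.adjoint (primY L₁ L₂) u =
    coordSwap L₂ L₁ (ContinuousLinearMap.adjoint (primX L₂ L₁) (coordSwap L₁ L₂ u)) := by
  rw [primY, adjoint_fiberOp₂, primX, adjoint_fiberOp]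
  exact fiberOp₂_apply _ _ _ u

lemma setIntegral_coordSwap (u : L2Scal L₁ L₂) {S : Set (ℝ × ℝ)} (hS : S ⊆ rect L₂ L₁)
    (g : ℝ × ℝ → ℝ) :
    ∫ p in S, coordSwap L₁ L₂ u p * g p = ∫ p in Prod.swap ⁻¹' S, u p * g p.swap := by
  have e : ∫ p in S, coordSwap L₁ L₂ u p * g p = ∫ p in S, u p.swap * g p := by
    refine integral_congr_ae ?_
    filter_upwards [ae_restrict_of_ae_restrict_of_subset hS
      (coeFn_swapOp (restrict_rect L₁ L₂) (restrict_rect L₂ L₁) u)] with p hp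
    simp only [coordSwap, hp]
  rw [e]
  have hmp : MeasurePreserving (Prod.swap : ℝ × ℝ → ℝ × ℝ) volume volume :=
    Measure.measurePreserving_swap
  have h := hmp.setIntegral_preimage_emb MeasurableEquiv.prodComm.measurableEmbedding
    (fun p => u p.swap * g p) S
  rw [← h]
  simp only [Prod.swap_swap]

lemma swap_preimage_rect : Prod.swap ⁻¹' rect L₂ L₁ = rect L₁ L₂ :=
  preimage_swap_prod _ _

lemma IsTestFunction.comp_swap {φ : ℝ × ℝ → ℝ} (h : IsTestFunction (rect L₁ L₂) φ) :
    IsTestFunction (rect L₂ L₁) (fun p => φ p.swap) := by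
  refine ⟨h.1.comp (contDiff_snd.prodMk contDiff_fst),
    h.2.1.comp_homeomorph (Homeomorph.prodComm ℝ ℝ), ?_⟩
  refine (tsupport_comp_subset_preimage φ continuous_swap).trans ?_
  rw [← swap_preimage_rect]
  exact preimage_mono h.2.2

lemma IsTestFunction.dx_comp_swap {φ : ℝ × ℝ → ℝ} (h : IsTestFunction (rect L₁ L₂) φ)
    (p : ℝ × ℝ) : dx (fun p => φ p.swap) p = dy φ p.swap := by
  have h1 := (h.comp_swap.1.differentiable (by simp) p).hasFDerivAt.comp_hasDerivAt
    p.1 ((hasDerivAt_id p.1).prodMk (hasDerivAt_const p.1 p.2))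
  have h2 := (h.1.differentiable (by simp) p.swap).hasFDerivAt.comp_hasDerivAt
    p.1 ((hasDerivAt_const p.1 p.2).prodMk (hasDerivAt_id p.1))
  exact h1.unique h2

lemma IsTestFunction.dy_comp_swap {φ : ℝ × ℝ → ℝ} (h : IsTestFunction (rect L₁ L₂) φ)
    (p : ℝ × ℝ) : dy (fun p => φ p.swap) p = dx φ p.swap := by
  have := h.comp_swap.dx_comp_swap p.swap
  simpa using this.symm

lemma HasWeakDx.coordSwap {u X : L2Scal L₁ L₂} (h : HasWeakDx u X) :
    HasWeakDy (coordSwap L₁ L₂ u) (coordSwap L₁ L₂ X) := by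
  intro φ hφ
  have := h _ hφ.comp_swap
  rw [setIntegral_coordSwap _ subset_rfl, setIntegral_coordSwap _ subset_rfl, swap_preimage_rect,
    this]
  simp only [hφ.dx_comp_swap]

lemma HasWeakDy.coordSwap {u X : L2Scal L₁ L₂} (h : HasWeakDy u X) :
    HasWeakDx (coordSwap L₁ L₂ u) (coordSwap L₁ L₂ X) := by
  intro φ hφ
  have := h _ hφ.comp_swap
  rw [setIntegral_coordSwap _ subset_rfl, setIntegral_coordSwap _ subset_rfl, swap_preimage_rect,
    this]
  simp only [hφ.dy_comp_swap]

lemma HasZeroTrace.coordSwap {strip : ℝ → Set (ℝ × ℝ)} {τ : ℝ × ℝ → ℝ} {ℓ : ℝ}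
    {u : L2Scal L₁ L₂} (h : HasZeroTrace strip τ ℓ u) :
    HasZeroTrace (fun ε => Prod.swap ⁻¹' strip ε) (fun p => τ p.swap) ℓ (coordSwap L₁ L₂ u) := by
  intro φ hφ
  refine (h φ hφ).congr fun ε => ?_
  rw [setIntegral_coordSwap u inter_subset_left (fun p => φ (τ p.swap)), preimage_inter,
    swap_preimage_rect, ← preimage_comp]
  simp

lemma ZeroWest.coordSwap {u : L2Scal L₁ L₂} (h : ZeroWest u) : ZeroSouth (coordSwap L₁ L₂ u) :=
  HasZeroTrace.coordSwap (strip := fun ε => {p | p.1 < ε}) (τ := Prod.snd) h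

lemma ZeroEast.coordSwap {u : L2Scal L₁ L₂} (h : ZeroEast u) : ZeroNorth (coordSwap L₁ L₂ u) :=
  HasZeroTrace.coordSwap (strip := fun ε => {p | L₁ - ε < p.1}) (τ := Prod.snd) h

lemma ZeroSouth.coordSwap {u : L2Scal L₁ L₂} (h : ZeroSouth u) : ZeroWest (coordSwap L₁ L₂ u) :=
  HasZeroTrace.coordSwap (strip := fun ε => {p | p.2 < ε}) (τ := Prod.fst) h

lemma ZeroNorth.coordSwap {u : L2Scal L₁ L₂} (h : ZeroNorth u) : ZeroEast (coordSwap L₁ L₂ u) :=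
  HasZeroTrace.coordSwap (strip := fun ε => {p | L₂ - ε < p.2}) (τ := Prod.fst) h

lemma hasWeakDy_primY (X : L2Scal L₁ L₂) : HasWeakDy (primY L₁ L₂ X) X := by
  have := (hasWeakDx_primX (EllipticMode.coordSwap L₁ L₂ X)).coordSwap
  rwa [← primY_apply, coordSwap_coordSwap] at this

lemma hasWeakDy_adjoint_primY (X : L2Scal L₁ L₂) :
    HasWeakDy (ContinuousLinearMap.adjoint (primY L₁ L₂) X) (-X) := by
  have := (hasWeakDx_adjoint_primX (EllipticMode.coordSwap L₁ L₂ X)).coordSwap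
  rwa [← adjoint_primY_apply, map_neg, coordSwap_coordSwap] at this

lemma zeroSouth_primY (X : L2Scal L₁ L₂) : ZeroSouth (primY L₁ L₂ X) := by
  rw [primY_apply]
  exact (zeroWest_primX _).coordSwap

lemma zeroNorth_adjoint_primY (X : L2Scal L₁ L₂) :
    ZeroNorth (ContinuousLinearMap.adjoint (primY L₁ L₂) X) := by
  rw [adjoint_primY_apply]
  exact (zeroEast_adjoint_primX _).coordSwap

lemma eq_primY (hL₂ : 0 < L₂) {u Y : L2Scal L₁ L₂} (h : HasWeakDy u Y) (ht : ZeroSouth u) :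
    u = primY L₁ L₂ Y := by
  rw [primY_apply, ← eq_primX hL₂ h.coordSwap ht.coordSwap, coordSwap_coordSwap]

lemma eq_adjoint_primY (hL₂ : 0 < L₂) {u Y : L2Scal L₁ L₂} (h : HasWeakDy u Y)
    (ht : ZeroNorth u) : u = ContinuousLinearMap.adjoint (primY L₁ L₂) (-Y) := by
  rw [adjoint_primY_apply, map_neg,
    ← eq_adjoint_primX hL₂ h.coordSwap ht.coordSwap, coordSwap_coordSwap]

end swap


/-! ### Components of vector fields -/

section components

/-- The `i`-th component of a vector field. -/
def comp (L₁ L₂ : ℝ) (i : Fin 2) : L2Vec L₁ L₂ →L[ℝ] L2Scal L₁ L₂ :=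
  (EuclideanSpace.proj i : EuclideanSpace ℝ (Fin 2) →L[ℝ] ℝ).compLpL 2 _

/-- The vector field with `i`-th component `u` and other component zero. -/
def inj (L₁ L₂ : ℝ) (i : Fin 2) : L2Scal L₁ L₂ →L[ℝ] L2Vec L₁ L₂ :=
  (ContinuousLinearMap.toSpanSingleton ℝ (EuclideanSpace.single i (1 : ℝ))).compLpL 2 _

lemma coeFn_comp (i : Fin 2) (Θ : L2Vec L₁ L₂) :
    comp L₁ L₂ i Θ =ᵐ[(volume : Measure (ℝ × ℝ)).restrict (rect L₁ L₂)] fun p => (Θ p) i :=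
  ContinuousLinearMap.coeFn_compLpL _ Θ

lemma coeFn_inj (i : Fin 2) (u : L2Scal L₁ L₂) :
    inj L₁ L₂ i u =ᵐ[(volume : Measure (ℝ × ℝ)).restrict (rect L₁ L₂)]
      fun p => u p • EuclideanSpace.single i (1 : ℝ) :=
  ContinuousLinearMap.coeFn_compLpL _ u

lemma comp_inj_self (i : Fin 2) (u : L2Scal L₁ L₂) : comp L₁ L₂ i (inj L₁ L₂ i u) = u := by
  refine Lp.ext ?_
  filter_upwards [coeFn_comp i (inj L₁ L₂ i u), coeFn_inj i u] with p h1 h2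
  rw [h1, h2]
  simp

lemma comp_inj_of_ne {i j : Fin 2} (hij : i ≠ j) (u : L2Scal L₁ L₂) :
    comp L₁ L₂ i (inj L₁ L₂ j u) = 0 := by
  refine Lp.ext ?_
  filter_upwards [coeFn_comp i (inj L₁ L₂ j u), coeFn_inj j u,
    Lp.coeFn_zero ℝ 2 ((volume : Measure (ℝ × ℝ)).restrict (rect L₁ L₂))] with p h1 h2 h3
  rw [h1, h2, h3]
  simp [hij]

lemma inner_eq_add_inner_comp (Θ Ψ : L2Vec L₁ L₂) :
    inner ℝ Θ Ψ = inner ℝ (comp L₁ L₂ 0 Θ) (comp L₁ L₂ 0 Ψ) +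
      inner ℝ (comp L₁ L₂ 1 Θ) (comp L₁ L₂ 1 Ψ) := by
  rw [inner_eq_integral, inner_eq_integral,
    ← integral_add (integrable_mul_of_memLp_two (Lp.memLp _) (Lp.memLp _))
      (integrable_mul_of_memLp_two (Lp.memLp _) (Lp.memLp _)), L2.inner_def]
  refine integral_congr_ae ?_
  filter_upwards [coeFn_comp 0 Θ, coeFn_comp 0 Ψ, coeFn_comp 1 Θ, coeFn_comp 1 Ψ]
    with p h1 h2 h3 h4
  rw [h1, h2, h3, h4, PiLp.inner_apply, Fin.sum_univ_two]
  simp [mul_comm]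

lemma inner_comp_zero (Θ : L2Vec L₁ L₂) (u : L2Scal L₁ L₂) :
    inner ℝ (comp L₁ L₂ 0 Θ) u = inner ℝ Θ (inj L₁ L₂ 0 u) := by
  rw [inner_eq_add_inner_comp, comp_inj_self, comp_inj_of_ne one_ne_zero, inner_zero_right,
    add_zero]

lemma inner_comp_one (Θ : L2Vec L₁ L₂) (u : L2Scal L₁ L₂) :
    inner ℝ (comp L₁ L₂ 1 Θ) u = inner ℝ Θ (inj L₁ L₂ 1 u) := by
  rw [inner_eq_add_inner_comp, comp_inj_self, comp_inj_of_ne zero_ne_one, inner_zero_right,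
    zero_add]

lemma comp_ext {Θ Ψ : L2Vec L₁ L₂} (h0 : comp L₁ L₂ 0 Θ = comp L₁ L₂ 0 Ψ)
    (h1 : comp L₁ L₂ 1 Θ = comp L₁ L₂ 1 Ψ) : Θ = Ψ :=
  ext_inner_right ℝ fun Φ => by rw [inner_eq_add_inner_comp, h0, h1, ← inner_eq_add_inner_comp]

lemma pairing_eq {S : Set (ℝ × ℝ)} (hS : S ⊆ rect L₁ L₂) (Θ : L2Vec L₁ L₂) (i : Fin 2)
    (g : ℝ × ℝ → ℝ) : pairing S Θ i g = ∫ p in S, comp L₁ L₂ i Θ p * g p := by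
  refine integral_congr_ae ?_
  filter_upwards [ae_restrict_of_ae_restrict_of_subset hS (coeFn_comp i Θ)] with p hp
  rw [hp]

lemma zeroTraceAlong_iff {strip : ℝ → Set (ℝ × ℝ)} {τ : ℝ × ℝ → ℝ} {ℓ : ℝ} {Θ : L2Vec L₁ L₂}
    {i : Fin 2} : ZeroTraceAlong strip τ ℓ Θ i ↔ HasZeroTrace strip τ ℓ (comp L₁ L₂ i Θ) := by
  simp only [ZeroTraceAlong, HasZeroTrace, pairing_eq inter_subset_left]

lemma mixedBC_iff {Θ : L2Vec L₁ L₂} : MixedBC Θ ↔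
    ZeroWest (comp L₁ L₂ 0 Θ) ∧ ZeroSouth (comp L₁ L₂ 0 Θ) ∧ ZeroEast (comp L₁ L₂ 1 Θ) ∧
      ZeroNorth (comp L₁ L₂ 1 Θ) :=
  and_congr zeroTraceAlong_iff
    (and_congr zeroTraceAlong_iff (and_congr zeroTraceAlong_iff zeroTraceAlong_iff))

lemma IsWeakImage.hasWeakDx {Θ G : L2Vec L₁ L₂} (h : IsWeakImage 1 0 Θ G) (i : Fin 2) :
    HasWeakDx (comp L₁ L₂ i Θ) (comp L₁ L₂ i G) := by
  intro φ hφ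
  have := h φ hφ i
  simpa [pairing_eq subset_rfl, Matrix.one_apply] using this

lemma IsWeakImage.hasWeakDy {Θ G : L2Vec L₁ L₂} (h : IsWeakImage 0 1 Θ G) (i : Fin 2) :
    HasWeakDy (comp L₁ L₂ i Θ) (comp L₁ L₂ i G) := by
  intro φ hφ
  have := h φ hφ i
  simpa [pairing_eq subset_rfl, Matrix.one_apply] using this

lemma integral_add_mul_test (f g : L2Scal L₁ L₂) {φ : ℝ × ℝ → ℝ}
    (hφ : IsTestFunction (rect L₁ L₂) φ) : ∫ p in rect L₁ L₂, (f + g) p * φ p =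
      (∫ p in rect L₁ L₂, f p * φ p) + ∫ p in rect L₁ L₂, g p * φ p := by
  rw [← integral_add (integrable_mul_of_memLp_two (Lp.memLp f) hφ.memLp)
    (integrable_mul_of_memLp_two (Lp.memLp g) hφ.memLp)]
  refine integral_congr_ae ?_
  filter_upwards [Lp.coeFn_add f g] with p hp
  rw [hp, Pi.add_apply, add_mul]

lemma integral_smul_mul_test (c : ℝ) (f : L2Scal L₁ L₂) (φ : ℝ × ℝ → ℝ) :
    ∫ p in rect L₁ L₂, (c • f) p * φ p = c * ∫ p in rect L₁ L₂, f p * φ p := by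
  rw [← integral_const_mul]
  refine integral_congr_ae ?_
  filter_upwards [Lp.coeFn_smul c f] with p hp
  rw [hp, Pi.smul_apply, smul_eq_mul, mul_assoc]

lemma isWeakImage_of_hasWeakDx_hasWeakDy {A B : Matrix (Fin 2) (Fin 2) ℝ} {Θ F : L2Vec L₁ L₂}
    {X Y : Fin 2 → L2Scal L₁ L₂} (hX : ∀ j, HasWeakDx (comp L₁ L₂ j Θ) (X j))
    (hY : ∀ j, HasWeakDy (comp L₁ L₂ j Θ) (Y j))
    (hF : ∀ i, comp L₁ L₂ i F = (A i 0 • X 0 + B i 0 • Y 0) + (A i 1 • X 1 + B i 1 • Y 1)) :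
    IsWeakImage A B Θ F := by
  intro φ hφ i
  simp only [pairing_eq subset_rfl, Fin.sum_univ_two]
  have x0 := hX 0 φ hφ
  have x1 := hX 1 φ hφ
  have y0 := hY 0 φ hφ
  have y1 := hY 1 φ hφ
  rw [hF, integral_add_mul_test _ _ hφ, integral_add_mul_test _ _ hφ,
    integral_add_mul_test _ _ hφ]
  simp only [integral_smul_mul_test]
  rw [x0, x1, y0, y1]
  ring

end components

/-! ### Primitive form of `V`, positivity and surjectivity of `𝒯` -/

section domain

local notation "𝒥" => primX L₁ L₂
local notation "𝒦" => primY L₁ L₂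
local notation "𝒥ᵃ" => ContinuousLinearMap.adjoint (primX L₁ L₂)
local notation "𝒦ᵃ" => ContinuousLinearMap.adjoint (primY L₁ L₂)

/-- A field of `V` is given by primitives: its first component by primitives from `Γ_W` and
`Γ_S`, the second one by primitives from `Γ_E` and `Γ_N`. -/
structure IsPrimitive (Θ : L2Vec L₁ L₂) (X Y X' Y' : L2Scal L₁ L₂) : Prop where
  west : comp L₁ L₂ 0 Θ = 𝒥 X
  south : comp L₁ L₂ 0 Θ = 𝒦 Y
  east : comp L₁ L₂ 1 Θ = 𝒥ᵃ X'
  north : comp L₁ L₂ 1 Θ = 𝒦ᵃ Y'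

variable {Θ F : L2Vec L₁ L₂} {X Y X' Y' : L2Scal L₁ L₂}

/-- The sign of `X'` arises because `∂ₓ` inverts `J*` only up to a factor `-1`. -/
lemma IsPrimitive.hasWeakDx (h : IsPrimitive Θ X Y X' Y') (j : Fin 2) :
    HasWeakDx (comp L₁ L₂ j Θ) (![X, -X'] j) := by
  fin_cases j
  · exact h.west ▸ hasWeakDx_primX X
  · exact h.east ▸ hasWeakDx_adjoint_primX X'

lemma IsPrimitive.hasWeakDy (h : IsPrimitive Θ X Y X' Y') (j : Fin 2) :
    HasWeakDy (comp L₁ L₂ j Θ) (![Y, -Y'] j) := by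
  fin_cases j
  · exact h.south ▸ hasWeakDy_primY Y
  · exact h.north ▸ hasWeakDy_adjoint_primY Y'

lemma IsPrimitive.isWeakImage (h : IsPrimitive Θ X Y X' Y') {A B : Matrix (Fin 2) (Fin 2) ℝ}
    (hF : ∀ i, comp L₁ L₂ i F = (A i 0 • X + B i 0 • Y) - (A i 1 • X' + B i 1 • Y')) :
    IsWeakImage A B Θ F := by
  refine isWeakImage_of_hasWeakDx_hasWeakDy h.hasWeakDx h.hasWeakDy fun i => ?_
  rw [hF]
  simp only [Matrix.cons_val_zero, Matrix.cons_val_one, smul_neg]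
  abel

lemma IsPrimitive.mem_V (h : IsPrimitive Θ X Y X' Y') : Θ ∈ V L₁ L₂ := by
  refine ⟨⟨⟨inj L₁ L₂ 0 X + inj L₁ L₂ 1 (-X'), h.isWeakImage (Fin.forall_fin_two.2 ⟨?_, ?_⟩)⟩,
    ⟨inj L₁ L₂ 0 Y + inj L₁ L₂ 1 (-Y'), h.isWeakImage (Fin.forall_fin_two.2 ⟨?_, ?_⟩)⟩⟩,
    mixedBC_iff.2 ⟨?_, ?_, ?_, ?_⟩⟩
  · simp [comp_inj_self, comp_inj_of_ne]
  · simp [comp_inj_self, comp_inj_of_ne]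
  · simp [comp_inj_self, comp_inj_of_ne]
  · simp [comp_inj_self, comp_inj_of_ne]
  · exact h.west ▸ zeroWest_primX X
  · exact h.south ▸ zeroSouth_primY Y
  · exact h.east ▸ zeroEast_adjoint_primX X'
  · exact h.north ▸ zeroNorth_adjoint_primY Y'

lemma exists_isPrimitive_of_mem_V (hL₁ : 0 < L₁) (hL₂ : 0 < L₂) (h : Θ ∈ V L₁ L₂) :
    ∃ X Y X' Y', IsPrimitive Θ X Y X' Y' := by
  obtain ⟨⟨⟨G, hG⟩, ⟨G', hG'⟩⟩, hb⟩ := h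
  obtain ⟨hw, hs, he, hn⟩ := mixedBC_iff.1 hb
  exact ⟨_, _, _, _, eq_primX hL₁ (hG.hasWeakDx 0) hw, eq_primY hL₂ (hG'.hasWeakDy 0) hs,
    eq_adjoint_primX hL₁ (hG.hasWeakDx 1) he, eq_adjoint_primY hL₂ (hG'.hasWeakDy 1) hn⟩

variable {α₁ α₂ β₁ β₂ : ℝ}

/-- The value of `opT` is defined by choice; uniqueness of the distributional image makes it
explicit. -/
lemma IsPrimitive.opT_eq {Θ : (opT L₁ L₂ α₁ α₂ β₁ β₂).domain}
    (h : IsPrimitive (Θ : L2Vec L₁ L₂) X Y X' Y')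
    (h0 : comp L₁ L₂ 0 F = (α₁ • X + α₂ • Y) - (β₁ • X' + β₂ • Y'))
    (h1 : comp L₁ L₂ 1 F = (β₁ • X + β₂ • Y) + (α₁ • X' + α₂ • Y')) :
    opT L₁ L₂ α₁ α₂ β₁ β₂ Θ = F := by
  refine (opT_spec L₁ L₂ α₁ α₂ β₁ β₂ Θ).unique (h.isWeakImage fun i => ?_)
  fin_cases i
  · simpa [coeff] using h0
  · simp only [coeff, Fin.mk_one, Matrix.of_apply, Matrix.cons_val', Matrix.cons_val_zero,
      Matrix.cons_val_one, Matrix.cons_val_fin_one, h1, neg_smul]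
    abel

lemma inner_primX_self_nonneg (X : L2Scal L₁ L₂) : 0 ≤ inner ℝ (𝒥 X) X :=
  inner_fiberOp_self_nonneg _ _ (below_add_below L₁) X

lemma inner_primY_self_nonneg (Y : L2Scal L₁ L₂) : 0 ≤ inner ℝ (𝒦 Y) Y :=
  inner_fiberOp₂_self_nonneg _ _ (below_add_below L₂) Y

/-- The operator `𝒯` is positive. -/
lemma inner_opT_self_nonneg (hL₁ : 0 < L₁) (hL₂ : 0 < L₂) (hα₁ : 0 < α₁) (hα₂ : 0 < α₂)
    (Θ : (opT L₁ L₂ α₁ α₂ β₁ β₂).domain) :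
    0 ≤ inner ℝ (opT L₁ L₂ α₁ α₂ β₁ β₂ Θ) (Θ : L2Vec L₁ L₂) := by
  obtain ⟨X, Y, X', Y', h⟩ := exists_isPrimitive_of_mem_V hL₁ hL₂ Θ.2
  have e0 : ∀ u v : L2Scal L₁ L₂, comp L₁ L₂ 0 (inj L₁ L₂ 0 u + inj L₁ L₂ 1 v) = u := fun u v => by
    simp [comp_inj_self, comp_inj_of_ne]
  have e1 : ∀ u v : L2Scal L₁ L₂, comp L₁ L₂ 1 (inj L₁ L₂ 0 u + inj L₁ L₂ 1 v) = v := fun u v => by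
    simp [comp_inj_self, comp_inj_of_ne]
  rw [h.opT_eq (e0 _ _) (e1 _ _), inner_eq_add_inner_comp, e0, e1]
  simp only [inner_add_left, inner_sub_left, real_inner_smul_left]
  have hX : inner ℝ X (comp L₁ L₂ 0 (Θ : L2Vec L₁ L₂)) = inner ℝ (𝒥 X) X := by
    rw [h.west, real_inner_comm]
  have hY : inner ℝ Y (comp L₁ L₂ 0 (Θ : L2Vec L₁ L₂)) = inner ℝ (𝒦 Y) Y := by
    rw [h.south, real_inner_comm]
  have hX' : inner ℝ X' (comp L₁ L₂ 1 (Θ : L2Vec L₁ L₂)) = inner ℝ (𝒥 X') X' := by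
    rw [h.east, ContinuousLinearMap.adjoint_inner_right]
  have hY' : inner ℝ Y' (comp L₁ L₂ 1 (Θ : L2Vec L₁ L₂)) = inner ℝ (𝒦 Y') Y' := by
    rw [h.north, ContinuousLinearMap.adjoint_inner_right]
  -- Together with `hc'` this cancels all terms containing `β₁` or `β₂`.
  have hc : inner ℝ X' (comp L₁ L₂ 0 (Θ : L2Vec L₁ L₂)) =
      inner ℝ X (comp L₁ L₂ 1 (Θ : L2Vec L₁ L₂)) := by
    rw [h.west, h.east, ContinuousLinearMap.adjoint_inner_right, real_inner_comm]
  have hc' : inner ℝ Y' (comp L₁ L₂ 0 (Θ : L2Vec L₁ L₂)) =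
      inner ℝ Y (comp L₁ L₂ 1 (Θ : L2Vec L₁ L₂)) := by
    rw [h.south, h.north, ContinuousLinearMap.adjoint_inner_right, real_inner_comm]
  rw [hX, hY, hX', hY', hc, hc']
  have p1 := mul_nonneg hα₁.le (inner_primX_self_nonneg X)
  have p2 := mul_nonneg hα₂.le (inner_primY_self_nonneg Y)
  have p3 := mul_nonneg hα₁.le (inner_primX_self_nonneg X')
  have p4 := mul_nonneg hα₂.le (inner_primY_self_nonneg Y')
  linarith

lemma primX_primY_comm (u : L2Scal L₁ L₂) : 𝒥 (𝒦 u) = 𝒦 (𝒥 u) :=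
  fiberOp_fiberOp₂_comm _ _ _ u

lemma adjoint_primX_adjoint_primY_comm (u : L2Scal L₁ L₂) : 𝒥ᵃ (𝒦ᵃ u) = 𝒦ᵃ (𝒥ᵃ u) :=
  ext_inner_right ℝ fun v => by
    simp only [ContinuousLinearMap.adjoint_inner_left, primX_primY_comm]

/-- If `B A* = 0`, every vector is the sum of an element of `ker A` and one of `ker B`. -/
lemma exists_add_of_comp_adjoint_eq_zero {E H : Type*} [NormedAddCommGroup E]
    [InnerProductSpace ℝ E] [CompleteSpace E] [NormedAddCommGroup H] [InnerProductSpace ℝ H]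
    [CompleteSpace H] (A B : E →L[ℝ] H)
    (h : ∀ w, B (ContinuousLinearMap.adjoint A w) = 0) (F : E) :
    ∃ p z, A p = 0 ∧ B z = 0 ∧ F = p + z := by
  have hclosed : IsClosed ((A : E →ₗ[ℝ] H).ker : Set E) := A.isClosed_ker
  have := hclosed.completeSpace_coe
  obtain ⟨p, hp, z, hz, rfl⟩ := Submodule.exists_add_mem_mem_orthogonal (K := (A : E →ₗ[ℝ] H).ker) F
  refine ⟨p, z, hp, ?_, rfl⟩
  -- The complement `(ker A)ᗮ` is the closure of the range of `A*`; that range lies in `ker B`,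
  -- which is closed.
  rw [ContinuousLinearMap.orthogonal_ker] at hz
  have hle : ((ContinuousLinearMap.adjoint A : H →L[ℝ] E) : H →ₗ[ℝ] E).range.topologicalClosure ≤
      (B : E →ₗ[ℝ] H).ker := by
    refine Submodule.topologicalClosure_minimal _ ?_ B.isClosed_ker
    rintro _ ⟨w, rfl⟩
    exact h w
  exact hle hz

/-- The operator `𝒯` is surjective. -/
lemma exists_opT_eq (hdet : α₂ * β₁ - α₁ * β₂ ≠ 0) (F : L2Vec L₁ L₂) :
    ∃ Θ : (opT L₁ L₂ α₁ α₂ β₁ β₂).domain, opT L₁ L₂ α₁ α₂ β₁ β₂ Θ = F := by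
  have he : α₁ * β₂ - α₂ * β₁ ≠ 0 := fun h => hdet (by linarith)
  set e := α₁ * β₂ - α₂ * β₁ with hed
  set c₀ := comp L₁ L₂ 0 with hc₀
  set c₁ := comp L₁ L₂ 1 with hc₁
  -- Solving `p = (α₁X + α₂Y, β₁X + β₂Y)` for `X, Y` by Cramer's rule turns `J X = K Y` into `A p =
  -- 0`. In the same way `z = (-β₁X' - β₂Y', α₁X' + α₂Y')` turns `J* X' = K* Y'` into `B z = 0`.
  let A : L2Vec L₁ L₂ →L[ℝ] L2Scal L₁ L₂ := 𝒥 ∘L (β₂ • c₀ - α₂ • c₁) + 𝒦 ∘L (β₁ • c₀ - α₁ • c₁)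
  let B : L2Vec L₁ L₂ →L[ℝ] L2Scal L₁ L₂ := 𝒥ᵃ ∘L (α₂ • c₀ + β₂ • c₁) + 𝒦ᵃ ∘L (α₁ • c₀ + β₁ • c₁)
  have hA0 : ∀ w, c₀ (ContinuousLinearMap.adjoint A w) = β₂ • 𝒥ᵃ w + β₁ • 𝒦ᵃ w := fun w =>
    ext_inner_right ℝ fun v => by
      rw [hc₀, inner_comp_zero, ContinuousLinearMap.adjoint_inner_left]
      simp [A, hc₀, hc₁, comp_inj_self, comp_inj_of_ne, inner_add_left, inner_add_right,
        real_inner_smul_left, real_inner_smul_right, ContinuousLinearMap.adjoint_inner_left]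
  have hA1 : ∀ w, c₁ (ContinuousLinearMap.adjoint A w) = -(α₂ • 𝒥ᵃ w + α₁ • 𝒦ᵃ w) := fun w =>
    ext_inner_right ℝ fun v => by
      rw [hc₁, inner_comp_one, ContinuousLinearMap.adjoint_inner_left]
      simp [A, hc₀, hc₁, comp_inj_self, comp_inj_of_ne, inner_add_left, inner_add_right,
        real_inner_smul_left, real_inner_smul_right, ContinuousLinearMap.adjoint_inner_left]
      ring
  -- The squares of `J*` and of `K*` cancel, and the mixed terms form a multiple of the commutator
  -- of `J*` and `K*`.
  have hBA : ∀ w, B (ContinuousLinearMap.adjoint A w) = 0 := fun w => by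
    simp only [B, add_apply, ContinuousLinearMap.comp_apply,
      smul_apply, hA0, hA1, map_add, map_smul, map_neg,
      adjoint_primX_adjoint_primY_comm]
    module
  obtain ⟨p, z, hp, hz, rfl⟩ := exists_add_of_comp_adjoint_eq_zero A B hBA F
  let X := e⁻¹ • (β₂ • c₀ p - α₂ • c₁ p)
  let Y := -(e⁻¹ • (β₁ • c₀ p - α₁ • c₁ p))
  let X' := e⁻¹ • (α₂ • c₀ z + β₂ • c₁ z)
  let Y' := -(e⁻¹ • (α₁ • c₀ z + β₁ • c₁ z))
  have hXY : 𝒥 X = 𝒦 Y := by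
    have : 𝒥 (β₂ • c₀ p - α₂ • c₁ p) = -𝒦 (β₁ • c₀ p - α₁ • c₁ p) := eq_neg_of_add_eq_zero_left hp
    simp only [X, Y, map_neg, map_smul] at this ⊢
    rw [this, smul_neg]
  have hXY' : 𝒥ᵃ X' = 𝒦ᵃ Y' := by
    have : 𝒥ᵃ (α₂ • c₀ z + β₂ • c₁ z) = -𝒦ᵃ (α₁ • c₀ z + β₁ • c₁ z) :=
      eq_neg_of_add_eq_zero_left hz
    simp only [X', Y', map_neg, map_smul] at this ⊢
    rw [this, smul_neg]
  have hprim : IsPrimitive (inj L₁ L₂ 0 (𝒥 X) + inj L₁ L₂ 1 (𝒥ᵃ X')) X Y X' Y' := by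
    have e0 : comp L₁ L₂ 0 (inj L₁ L₂ 0 (𝒥 X) + inj L₁ L₂ 1 (𝒥ᵃ X')) = 𝒥 X := by
      simp [comp_inj_self, comp_inj_of_ne]
    have e1 : comp L₁ L₂ 1 (inj L₁ L₂ 0 (𝒥 X) + inj L₁ L₂ 1 (𝒥ᵃ X')) = 𝒥ᵃ X' := by
      simp [comp_inj_self, comp_inj_of_ne]
    exact ⟨e0, e0.trans hXY, e1, e1.trans hXY'⟩
  refine ⟨⟨_, hprim.mem_V⟩, hprim.opT_eq ?_ ?_⟩
  · simp only [map_add, ← hc₀, X, Y, X', Y']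
    match_scalars <;> field_simp <;> ring
  · simp only [map_add, ← hc₁, X, Y, X', Y']
    match_scalars <;> field_simp <;> ring

end domain

/-! ### Density of `V` -/

section density

lemma toLp_eq_primX {φ : ℝ × ℝ → ℝ} (hφ : IsTestFunction (rect L₁ L₂) φ) :
    hφ.memLp.toLp φ = primX L₁ L₂ (hφ.memLp_dx.toLp (dx φ)) := by
  refine Lp.ext ?_
  have h := fiberIntegral_congr (μ := volume.restrict (Ioo 0 L₁)) (ν := volume.restrict (Ioo 0 L₂))
    below (f := hφ.memLp_dx.toLp (dx φ)) (g := dx φ)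
    (by rw [← restrict_rect]; exact MemLp.coeFn_toLp hφ.memLp_dx)
  rw [← restrict_rect] at h
  filter_upwards [MemLp.coeFn_toLp (hφ.memLp (L₁ := L₁) (L₂ := L₂)), h,
    coeFn_fiberOp (restrict_rect L₁ L₂) isKernel_below (hφ.memLp_dx.toLp (dx φ)),
    ae_restrict_mem (measurableSet_rect L₁ L₂)] with p h1 h2 h3 hp
  have h0 : φ (0, p.2) = 0 := hφ.eq_zero fun hh => lt_irrefl _ hh.1.1
  rw [h1, primX, h3, h2, fiberIntegral, integral_below_mul hp.1 (fun s => dx φ (s, p.2)),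
    hφ.integral_dx, h0, sub_zero]

lemma toLp_eq_adjoint_primX {φ : ℝ × ℝ → ℝ} (hφ : IsTestFunction (rect L₁ L₂) φ) :
    hφ.memLp.toLp φ =
      ContinuousLinearMap.adjoint (primX L₁ L₂) (-hφ.memLp_dx.toLp (dx φ)) := by
  rw [map_neg, primX, adjoint_fiberOp]
  refine Lp.ext ?_
  have h := fiberIntegral_congr (μ := volume.restrict (Ioo 0 L₁)) (ν := volume.restrict (Ioo 0 L₂))
    (fun x s => below s x) (f := hφ.memLp_dx.toLp (dx φ)) (g := dx φ)
    (by rw [← restrict_rect]; exact MemLp.coeFn_toLp hφ.memLp_dx)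
  rw [← restrict_rect] at h
  filter_upwards [MemLp.coeFn_toLp (hφ.memLp (L₁ := L₁) (L₂ := L₂)), h,
    coeFn_fiberOp (restrict_rect L₁ L₂) isKernel_below.swap (hφ.memLp_dx.toLp (dx φ)),
    Lp.coeFn_neg (fiberOp (restrict_rect L₁ L₂) isKernel_below.swap (hφ.memLp_dx.toLp (dx φ))),
    ae_restrict_mem (measurableSet_rect L₁ L₂)] with p h1 h2 h3 h4 hp
  have h0 : φ (L₁, p.2) = 0 := hφ.eq_zero fun hh => lt_irrefl _ hh.1.2
  rw [h1, h4, Pi.neg_apply, h3, h2, fiberIntegral,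
    integral_above_mul hp.1 (fun s => dx φ (s, p.2)), hφ.integral_dx, h0, zero_sub, neg_neg]

lemma coordSwap_toLp {φ : ℝ × ℝ → ℝ} (hφ : IsTestFunction (rect L₁ L₂) φ) :
    coordSwap L₂ L₁ (hφ.comp_swap.memLp.toLp (fun p => φ p.swap)) = hφ.memLp.toLp φ := by
  refine Lp.ext ?_
  have hmp : MeasurePreserving (Prod.swap : ℝ × ℝ → ℝ × ℝ)
      ((volume : Measure (ℝ × ℝ)).restrict (rect L₁ L₂))
      ((volume : Measure (ℝ × ℝ)).restrict (rect L₂ L₁)) := by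
    rw [restrict_rect, restrict_rect]
    exact Measure.measurePreserving_swap
  filter_upwards [MemLp.coeFn_toLp (hφ.memLp (L₁ := L₁) (L₂ := L₂)),
    coeFn_swapOp (restrict_rect L₂ L₁) (restrict_rect L₁ L₂)
      (hφ.comp_swap.memLp.toLp (fun p => φ p.swap)),
    hmp.quasiMeasurePreserving.ae (MemLp.coeFn_toLp (hφ.comp_swap.memLp (L₁ := L₂) (L₂ := L₁)))]
    with p h1 h2 h3
  rw [coordSwap, h2, h3, h1, Prod.swap_swap]

/-- A test function vanishes near every side, so it can be recovered from its derivatives by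
integration from any of the four. -/
lemma exists_toLp_eq_primitives {φ : ℝ × ℝ → ℝ} (hφ : IsTestFunction (rect L₁ L₂) φ) :
    ∃ X Y, hφ.memLp.toLp φ = primX L₁ L₂ X ∧ hφ.memLp.toLp φ = primY L₁ L₂ Y ∧
      hφ.memLp.toLp φ = ContinuousLinearMap.adjoint (primX L₁ L₂) (-X) ∧
      hφ.memLp.toLp φ = ContinuousLinearMap.adjoint (primY L₁ L₂) (-Y) := by
  refine ⟨hφ.memLp_dx.toLp _, coordSwap L₂ L₁ (hφ.comp_swap.memLp_dx.toLp _), toLp_eq_primX hφ, ?_,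
    toLp_eq_adjoint_primX hφ, ?_⟩
  · rw [primY_apply, coordSwap_coordSwap, ← toLp_eq_primX hφ.comp_swap, coordSwap_toLp hφ]
  · rw [adjoint_primY_apply, map_neg, coordSwap_coordSwap, ← toLp_eq_adjoint_primX hφ.comp_swap,
      coordSwap_toLp hφ]

lemma inj_zero_toLp_mem_V {φ : ℝ × ℝ → ℝ} (hφ : IsTestFunction (rect L₁ L₂) φ) :
    inj L₁ L₂ 0 (hφ.memLp.toLp φ) ∈ V L₁ L₂ := by
  obtain ⟨X, Y, h1, h2, -, -⟩ := exists_toLp_eq_primitives hφ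
  refine IsPrimitive.mem_V (X := X) (Y := Y) (X' := 0) (Y' := 0) ⟨?_, ?_, ?_, ?_⟩
  · rw [comp_inj_self, h1]
  · rw [comp_inj_self, h2]
  · rw [comp_inj_of_ne one_ne_zero, map_zero]
  · rw [comp_inj_of_ne one_ne_zero, map_zero]

lemma inj_one_toLp_mem_V {φ : ℝ × ℝ → ℝ} (hφ : IsTestFunction (rect L₁ L₂) φ) :
    inj L₁ L₂ 1 (hφ.memLp.toLp φ) ∈ V L₁ L₂ := by
  obtain ⟨X, Y, -, -, h1, h2⟩ := exists_toLp_eq_primitives hφ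
  refine IsPrimitive.mem_V (X := 0) (Y := 0) (X' := -X) (Y' := -Y) ⟨?_, ?_, ?_, ?_⟩
  · rw [comp_inj_of_ne zero_ne_one, map_zero]
  · rw [comp_inj_of_ne zero_ne_one, map_zero]
  · rw [comp_inj_self, h1]
  · rw [comp_inj_self, h2]

lemma eq_zero_of_forall_inner_toLp {u : L2Scal L₁ L₂}
    (h : ∀ φ (hφ : IsTestFunction (rect L₁ L₂) φ), inner ℝ u (hφ.memLp.toLp φ) = 0) : u = 0 := by
  have hO : IsOpen (rect L₁ L₂) := isOpen_Ioo.prod isOpen_Ioo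
  have hloc : LocallyIntegrableOn u (rect L₁ L₂) volume :=
    IntegrableOn.locallyIntegrableOn ((Lp.memLp u).integrable (by norm_num))
  refine (Lp.eq_zero_iff_ae_eq_zero).2 ((ae_restrict_iff' hO.measurableSet).2 ?_)
  refine hO.ae_eq_zero_of_integral_contDiff_smul_eq_zero hloc fun φ h1 h2 h3 => ?_
  have hφ : IsTestFunction (rect L₁ L₂) φ := ⟨h1, h2, h3⟩
  rw [← h φ hφ, inner_eq_integral,
    ← setIntegral_eq_integral_of_forall_compl_eq_zero (s := rect L₁ L₂)]
  · refine integral_congr_ae ?_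
    filter_upwards [MemLp.coeFn_toLp (hφ.memLp (L₁ := L₁) (L₂ := L₂))] with p hp
    rw [hp, smul_eq_mul, mul_comm]
  · intro p hp
    simp [hφ.eq_zero hp]

/-- Test functions placed in either component belong to `V`, so a field orthogonal to `V` has
components orthogonal to all test functions. -/
lemma dense_V (L₁ L₂ : ℝ) : Dense (V L₁ L₂ : Set (L2Vec L₁ L₂)) := by
  rw [Submodule.dense_iff_topologicalClosure_eq_top, Submodule.topologicalClosure_eq_top_iff,
    Submodule.eq_bot_iff]
  intro Ψ hΨ
  refine comp_ext ?_ ?_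
  · rw [map_zero]
    refine eq_zero_of_forall_inner_toLp fun φ hφ => ?_
    rw [inner_comp_zero]
    exact Submodule.inner_left_of_mem_orthogonal (inj_zero_toLp_mem_V hφ) hΨ
  · rw [map_zero]
    refine eq_zero_of_forall_inner_toLp fun φ hφ => ?_
    rw [inner_comp_one]
    exact Submodule.inner_left_of_mem_orthogonal (inj_one_toLp_mem_V hφ) hΨ

end density

/-! ### Positivity of adjoints -/

/-- The adjoint of a densely defined operator that extends a surjective positive one is
positive. -/
lemma inner_adjoint_self_nonneg {E : Type*} [NormedAddCommGroup E] [InnerProductSpace ℝ E]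
    [CompleteSpace E] {S T : E →ₗ.[ℝ] E} (hS : ∀ F, ∃ Θ : S.domain, S Θ = F)
    (hpos : ∀ Θ : S.domain, 0 ≤ inner ℝ (S Θ) (Θ : E)) (hST : S ≤ T)
    (hT : Dense (T.domain : Set E)) (Ψ : T†.domain) : 0 ≤ inner ℝ (T† Ψ) (Ψ : E) := by
  -- Surjectivity represents `T† Ψ` as `S Θ`, which reduces the form of `T†` at `Ψ` to the form of
  -- `S` at `Θ`.
  obtain ⟨Θ, hΘ⟩ := hS (T† Ψ)
  have h1 : T ⟨Θ, hST.1 Θ.2⟩ = S Θ := (hST.2 rfl).symm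
  have h2 := LinearPMap.adjoint_isFormalAdjoint hT Ψ ⟨Θ, hST.1 Θ.2⟩
  rw [h1, hΘ] at h2
  rw [real_inner_comm, ← h2, ← hΘ]
  exact hpos Θ

end EllipticMode

end

namespace EllipticMode

lemma opT_le_opTMax (L₁ L₂ α₁ α₂ β₁ β₂ : ℝ) :
    opT L₁ L₂ α₁ α₂ β₁ β₂ ≤ opTMax L₁ L₂ α₁ α₂ β₁ β₂ :=
  ⟨V_le_maximalDomain _ _, fun Θ Ψ h =>
    congrArg (opTMax L₁ L₂ α₁ α₂ β₁ β₂).toFun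
      (Subtype.ext h : Submodule.inclusion (V_le_maximalDomain _ _) Θ = Ψ)⟩

end EllipticMode

theorem mainTheorem7 (L₁ L₂ α₁ α₂ β₁ β₂ : ℝ) (hL₁ : 0 < L₁) (hL₂ : 0 < L₂)
    (hα₁ : 0 < α₁) (hα₂ : 0 < α₂) (hdet : α₂ * β₁ - α₁ * β₂ ≠ 0) :
    Dense ((EllipticMode.opT L₁ L₂ α₁ α₂ β₁ β₂).domain : Set (EllipticMode.L2Vec L₁ L₂)) ∧
    (∀ Θ : (EllipticMode.opT L₁ L₂ α₁ α₂ β₁ β₂).domain,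
      0 ≤ inner ℝ (EllipticMode.opT L₁ L₂ α₁ α₂ β₁ β₂ Θ) (Θ : EllipticMode.L2Vec L₁ L₂)) ∧
    (∀ Ψ : (EllipticMode.opT L₁ L₂ α₁ α₂ β₁ β₂)†.domain,
      0 ≤ inner ℝ ((EllipticMode.opT L₁ L₂ α₁ α₂ β₁ β₂)† Ψ) (Ψ : EllipticMode.L2Vec L₁ L₂)) ∧
    (∀ Ψ : (EllipticMode.opTMax L₁ L₂ α₁ α₂ β₁ β₂)†.domain,
      0 ≤ inner ℝ ((EllipticMode.opTMax L₁ L₂ α₁ α₂ β₁ β₂)† Ψ)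
        (Ψ : EllipticMode.L2Vec L₁ L₂)) := by
  have hV : Dense ((EllipticMode.opT L₁ L₂ α₁ α₂ β₁ β₂).domain :
      Set (EllipticMode.L2Vec L₁ L₂)) := EllipticMode.dense_V L₁ L₂
  have hpos := EllipticMode.inner_opT_self_nonneg (β₁ := β₁) (β₂ := β₂) hL₁ hL₂ hα₁ hα₂
  have hsurj := EllipticMode.exists_opT_eq (L₁ := L₁) (L₂ := L₂) hdet
  have hle := EllipticMode.opT_le_opTMax L₁ L₂ α₁ α₂ β₁ β₂
  exact ⟨hV, hpos, EllipticMode.inner_adjoint_self_nonneg hsurj hpos le_rfl hV,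
    EllipticMode.inner_adjoint_self_nonneg hsurj hpos hle (hV.mono hle.1)⟩
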